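/- Let $n,k\ge 0$ and $r\ge 1$ be integers and let $\mathcal T_h$ be a finite conforming mesh of boxes in $\mathbb R^n$: finitely many products of $n$ nondegenerate closed intervals, any two of which are disjoint or intersect in a common face. Notation. Write polynomial $k$-forms as $u=\sum_\sigma u_\sigma\,dx_\sigma$, the sum being over the subsets $\sigma\subset\{1,\dots,n\}$ with $k$ elements; let $d$ be the exterior derivative and $\kappa$ the Koszul operator (contraction with the position vector $x$). Let $\mathcal Q_r\Lambda^k$ be the span of the forms $x^\alpha dx_\sigma$ with $|\sigma|=k$ and $\alpha_i\le r$ for all $i$; let $\mathcal Q_r^-\Lambda^k$ be the span of those with $\alpha_i\ne r$ for all $i\in\sigma$, and $\mathcal B_r\Lambda^k$ the span of those with $\alpha_i=r$ for some $i\in\sigma$; and let $\tilde{\mathcal Q}_r\Lambda^k=\mathcal Q_r^-\Lambda^k+d\kappa\,\mathcal B_r\Lambda^k$. For a face $f$ of a box, $\mathcal Q_r^-\Lambda^j(f)$ is the analogous space of $j$-forms in the coordinates that vary on $f$, and $\operatorname{tr}_f$ is the pullback to $f$. Let $\tilde{\mathcal Q}_r\Lambda^k(\mathcal T_h)$ and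 $\mathcal Q_r^-\Lambda^k(\mathcal T_h)$ be the spaces of piecewise polynomial $k$-forms whose restriction to each $T\in\mathcal T_h$ is in $\tilde{\mathcal Q}_r\Lambda^k$, respectively $\mathcal Q_r^-\Lambda^k$, and whose traces from different elements agree on every common face; let $\mathcal Q_{r-1}^d\Lambda^k(\mathcal T_h)$ be the space of piecewise $\mathcal Q_{r-1}\Lambda^k$ forms without any continuity condition. Put $$\langle u,v\rangle_h=\sum_{T\in\mathcal T_h}|T|\sum_{\sigma}E_r^T(u_\sigma v_\sigma),$$ where $E_r^T$ is the tensor product of the $(r+1)$-point Gauss–Lobatto rules, scaled to $T$ and normalized by $E_r^T(1)=1$. Statement. There is a linear map $\Pi_h:\tilde{\mathcal Q}_r\Lambda^k(\mathcal T_h)\to\mathcal Q_r^-\Lambda^k(\mathcal T_h)$ such that, for each $u\in\tilde{\mathcal Q}_r\Lambda^k(\mathcal T_h)$, $\Pi_h u$ is the unique element of $\mathcal Q_r^-\Lambda^k(\mathcal T_h)$ with $$\int_f\operatorname{tr}_f\Pi_h u\wedge q=\int_f\operatorname{tr}_f u\wedge q$$ for all $l\ge k$, all $l$-dimensional faces $f$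 of each element (the traces being taken from that element) and all $q\in\mathcal Q_{r-1}^-\Lambda^{l-k}(f)$; and $$\langle u-\Pi_h u,\,v\rangle_h=0\qquad\text{for all }u\in\tilde{\mathcal Q}_r\Lambda^k(\mathcal T_h),\ v\in\mathcal Q_{r-1}^d\Lambda^k(\mathcal T_h).$$ -/

import Mathlib

noncomputable section

namespace CubicalForms

open MeasureTheory

/-- Polynomial differential forms on `ℝⁿ` (of mixed degree): the family `u` stands for
`∑_σ u_σ dx_σ`, where `dx_σ = dx_{σ₁} ∧ ⋯ ∧ dx_{σ_k}` for `σ = {σ₁ < ⋯ < σ_k}`.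
A `k`-form is one whose coefficients vanish unless `σ` has `k` elements. -/
abbrev PolyForm (n : ℕ) : Type := Finset (Fin n) → MvPolynomial (Fin n) ℝ

/-- The form monomial `x^α dx_σ`. -/
def formMonomial {n : ℕ} (α : Fin n →₀ ℕ) (σ : Finset (Fin n)) : PolyForm n :=
  Pi.single σ (MvPolynomial.monomial α 1)

/-- `ε(i, σ) = (-1)^{|{j ∈ σ : j < i}|}`, so that `dx_i ∧ dx_σ = ε(i, σ) dx_{σ ∪ {i}}`
for `i ∉ σ`. -/
def eps {n : ℕ} (i : Fin n) (σ : Finset (Fin n)) : ℝ :=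
  (-1) ^ (σ.filter (fun j => j < i)).card

/-- The exterior derivative `d(∑ u_σ dx_σ) = ∑_σ ∑_i ∂_i u_σ dx_i ∧ dx_σ`. -/
def extD (n : ℕ) : PolyForm n →ₗ[ℝ] PolyForm n where
  toFun u τ := ∑ i ∈ τ, eps i (τ.erase i) • MvPolynomial.pderiv i (u (τ.erase i))
  map_add' u v := by
    funext τ
    simp [Finset.sum_add_distrib]
  map_smul' c u := by
    funext τ
    simp only [Pi.smul_apply, RingHom.id_apply, Finset.smul_sum, Derivation.map_smul]
    exact Finset.sum_congr rfl fun i _ => smul_comm _ _ _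

/-- The Koszul operator, contraction with the position vector `x`:
`κ(dx_σ) = ∑_{i ∈ σ} ε(i, σ \ {i}) x_i dx_{σ \ {i}}`. -/
def koszul (n : ℕ) : PolyForm n →ₗ[ℝ] PolyForm n where
  toFun u τ := ∑ i ∈ τᶜ, eps i τ • (MvPolynomial.X i * u (insert i τ))
  map_add' u v := by
    funext τ
    simp [Finset.sum_add_distrib, mul_add]
  map_smul' c u := by
    funext τ
    simp only [Pi.smul_apply, RingHom.id_apply, Finset.smul_sum, mul_smul_comm]
    exact Finset.sum_congr rfl fun i _ => smul_comm _ _ _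

/-- The sign in `dx_σ ∧ dx_ρ = ± dx_{σ ∪ ρ}` for disjoint `σ`, `ρ`. -/
def shuffleSign {n : ℕ} (σ ρ : Finset (Fin n)) : ℝ :=
  (-1) ^ ((σ ×ˢ ρ).filter (fun p => p.2 < p.1)).card

/-- The wedge product of polynomial forms. -/
def wedge {n : ℕ} (u v : PolyForm n) : PolyForm n := fun τ =>
  ∑ σ ∈ τ.powerset, shuffleSign σ (τ \ σ) • (u σ * v (τ \ σ))

/-- The conforming `s`-degree of `x^α dx_σ`: the number of `i ∈ σ` with `α_i = s`. -/
def cdeg {n : ℕ} (s : ℕ) (α : Fin n →₀ ℕ) (σ : Finset (Fin n)) : ℕ :=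
  (σ.filter (fun i => α i = s)).card

/-- `Q_r Λ^k`: `k`-forms whose coefficients have degree at most `r` in each variable. -/
def Q (n r k : ℕ) : Submodule ℝ (PolyForm n) :=
  Submodule.span ℝ {m | ∃ (α : Fin n →₀ ℕ) (σ : Finset (Fin n)),
    σ.card = k ∧ (∀ i, α i ≤ r) ∧ m = formMonomial α σ}

/-- `Q_r^- Λ^k` on a coordinate plane with free variables `x_i`, `i ∈ I`: the span of the
form monomials `x^α dx_σ` in these variables with all exponents at most `r` and with
`cdeg_r (x^α dx_σ) = 0`. -/
def QMinusOn {n : ℕ} (I : Finset (Fin n)) (r k : ℕ) : Submodule ℝ (PolyForm n) :=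
  Submodule.span ℝ {m | ∃ (α : Fin n →₀ ℕ) (σ : Finset (Fin n)),
    σ ⊆ I ∧ α.support ⊆ I ∧ σ.card = k ∧ (∀ i, α i ≤ r) ∧ cdeg r α σ = 0 ∧
      m = formMonomial α σ}

/-- `Q_r^- Λ^k` on `ℝⁿ`. -/
def QMinus (n r k : ℕ) : Submodule ℝ (PolyForm n) := QMinusOn Finset.univ r k

/-- `B_r Λ^k`: the span of the form monomials of `Q_r Λ^k` with `cdeg_r > 0`. -/
def B (n r k : ℕ) : Submodule ℝ (PolyForm n) :=
  Submodule.span ℝ {m | ∃ (α : Fin n →₀ ℕ) (σ : Finset (Fin n)),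
    σ.card = k ∧ (∀ i, α i ≤ r) ∧ 0 < cdeg r α σ ∧ m = formMonomial α σ}

/-- The shape functions `Q̃_r Λ^k = Q_r^- Λ^k + d κ B_r Λ^k`. -/
def QTilde (n r k : ℕ) : Submodule ℝ (PolyForm n) :=
  QMinus n r k ⊔ (B n r k).map (extD n ∘ₗ koszul n)

/-- A closed, possibly degenerate, axis-parallel box `∏ [lo_i, hi_i]` in `ℝⁿ`. -/
structure Cell (n : ℕ) where
  lo : Fin n → ℝ
  hi : Fin n → ℝ
  le : lo ≤ hi

namespace Cell

variable {n : ℕ}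

/-- The indices of the coordinates that are not constant on the cell. -/
def free (f : Cell n) : Finset (Fin n) := Finset.univ.filter (fun i => f.lo i < f.hi i)

/-- The dimension of the cell. -/
def dim (f : Cell n) : ℕ := f.free.card

/-- `f` is a face (of any dimension, `T` included) of the `n`-dimensional box `T`. -/
def IsFace (f : Cell n) (T : BoxIntegral.Box (Fin n)) : Prop :=
  ∀ i, (f.lo i = T.lower i ∧ f.hi i = T.upper i) ∨
    (f.lo i = T.lower i ∧ f.hi i = T.lower i) ∨
    (f.lo i = T.upper i ∧ f.hi i = T.upper i)

/-- The trace on `f`, i.e. the pullback to the coordinate plane spanned by `f`: `dx_j` is sent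
to zero and `x_j` to its constant value, for `j` not free. -/
def tr (f : Cell n) (u : PolyForm n) : PolyForm n := fun σ =>
  if σ ⊆ f.free then
    MvPolynomial.aeval (fun i => if i ∈ f.free then MvPolynomial.X i
      else MvPolynomial.C (f.lo i)) (u σ)
  else 0

/-- The point of the plane of `f` with given free coordinates. -/
def point (f : Cell n) (y : {i // i ∈ f.free} → ℝ) : Fin n → ℝ := fun i =>
  if h : i ∈ f.free then y ⟨i, h⟩ else f.lo i

/-- The integral over `f`, oriented by the increasing order of its free coordinates, of the
component of `ω` of degree `dim f`: the coefficient of `dx_{free f}` is integrated over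
`∏_{i free} [lo_i, hi_i]` with respect to Lebesgue measure (point evaluation if `dim f = 0`). -/
def integral (f : Cell n) (ω : PolyForm n) : ℝ :=
  ∫ y in Set.Icc (fun i : {i // i ∈ f.free} => f.lo i) (fun i => f.hi i),
    MvPolynomial.eval (f.point y) (ω f.free)

end Cell

/-- A conforming cubical mesh: finitely many boxes (products of nondegenerate closed intervals)
such that any two of them are disjoint or meet in a common face. -/
structure CubicalMesh (n : ℕ) where
  cells : Finset (BoxIntegral.Box (Fin n))
  conforming : ∀ T ∈ cells, ∀ T' ∈ cells,
    (Set.Icc T.lower T.upper ∩ Set.Icc T'.lower T'.upper).Nonempty →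
      ∃ f : Cell n, f.IsFace T ∧ f.IsFace T' ∧
        Set.Icc T.lower T.upper ∩ Set.Icc T'.lower T'.upper = Set.Icc f.lo f.hi

/-- The Legendre polynomial `L_r`, by Rodrigues' formula. -/
def legendre (r : ℕ) : Polynomial ℝ :=
  Polynomial.C (1 / (2 ^ r * (r.factorial : ℝ))) *
    Polynomial.derivative^[r] ((Polynomial.X ^ 2 - 1) ^ r)

/-- The nodes of the Gauss–Lobatto rule with `r + 1` points on `[-1, 1]`: the two end points
and the zeros of `L_r'`. -/
def glNodes (r : ℕ) : Finset ℝ :=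
  insert (-1) (insert 1 (Polynomial.derivative (legendre r)).roots.toFinset)

/-- The Gauss–Lobatto weight at the node `ξ`: the integral over `[-1, 1]` of the Lagrange basis
polynomial of `ξ`. -/
def glWeight (r : ℕ) (ξ : ℝ) : ℝ :=
  ∫ t in (-1 : ℝ)..1, (Lagrange.basis (glNodes r) id ξ).eval t

/-- The image of a point of `[-1, 1]ⁿ` under the affine map (diagonal scaling and translation)
onto the box `T`. -/
def fromRef {n : ℕ} (T : BoxIntegral.Box (Fin n)) (ξ : Fin n → ℝ) : Fin n → ℝ := fun i =>
  (T.lower i + T.upper i) / 2 + (T.upper i - T.lower i) / 2 * ξ i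

/-- The tensor product Gauss–Lobatto rule scaled to `T`, with weights of total mass `1`
(so that `|T| E_r^T` approximates the integral over `T`). -/
def evalE {n : ℕ} (r : ℕ) (T : BoxIntegral.Box (Fin n)) (g : (Fin n → ℝ) → ℝ) : ℝ :=
  ∑ ξ ∈ Fintype.piFinset (fun _ : Fin n => glNodes r),
    (∏ i, glWeight r (ξ i) / 2) * g (fromRef T ξ)

/-- `⟨u, v⟩_{h,T} = |T| ∑_{σ ∈ Σ_k} E_r^T(u_σ v_σ)`. -/
def quadInnerOn {n : ℕ} (r k : ℕ) (T : BoxIntegral.Box (Fin n)) (u v : PolyForm n) : ℝ :=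
  (∏ i, (T.upper i - T.lower i)) *
    ∑ σ ∈ Finset.powersetCard k (Finset.univ : Finset (Fin n)),
      evalE r T (fun x => MvPolynomial.eval x (u σ) * MvPolynomial.eval x (v σ))

namespace CubicalMesh

variable {n : ℕ}

/-- Piecewise polynomial forms on the mesh: a polynomial form `u|_T` for each element `T`. -/
abbrev PiecewiseForm (𝒯 : CubicalMesh n) : Type := {T // T ∈ 𝒯.cells} → PolyForm n

/-- The finite element space with local shape functions `S`: piecewise forms with `u|_T ∈ S`
whose traces from different elements agree on every common face. -/
def assemble (𝒯 : CubicalMesh n) (S : Submodule ℝ (PolyForm n)) :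
    Submodule ℝ 𝒯.PiecewiseForm where
  carrier := {u | (∀ T, u T ∈ S) ∧
    ∀ (T T' : {T // T ∈ 𝒯.cells}) (f : Cell n), f.IsFace T.1 → f.IsFace T'.1 →
      f.tr (u T) = f.tr (u T')}
  add_mem' := by
    rintro u v ⟨hu, hu'⟩ ⟨hv, hv'⟩
    refine ⟨fun T => S.add_mem (hu T) (hv T), fun T T' f h h' => ?_⟩
    funext σ
    have h1 := congrFun (hu' T T' f h h') σ
    have h2 := congrFun (hv' T T' f h h') σ
    unfold Cell.tr at h1 h2 ⊢
    split_ifs at h1 h2 ⊢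
    · simp only [Pi.add_apply, map_add, h1, h2]
    · rfl
  zero_mem' := ⟨fun _ => S.zero_mem, fun _ _ _ _ _ => rfl⟩
  smul_mem' := by
    rintro c u ⟨hu, hu'⟩
    refine ⟨fun T => S.smul_mem c (hu T), fun T T' f h h' => ?_⟩
    funext σ
    have h1 := congrFun (hu' T T' f h h') σ
    unfold Cell.tr at h1 ⊢
    split_ifs at h1 ⊢
    · simp only [Pi.smul_apply, map_smul, h1]
    · rfl

/-- `Q̃_r Λ^k(𝒯)`. -/
def QTildeSpace (𝒯 : CubicalMesh n) (r k : ℕ) : Submodule ℝ 𝒯.PiecewiseForm :=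
  𝒯.assemble (QTilde n r k)

/-- `Q_r^- Λ^k(𝒯)`. -/
def QMinusSpace (𝒯 : CubicalMesh n) (r k : ℕ) : Submodule ℝ 𝒯.PiecewiseForm :=
  𝒯.assemble (QMinus n r k)

/-- `Q_s^d Λ^k(𝒯)`: discontinuous piecewise `Q_s Λ^k` forms. -/
def QDiscSpace (𝒯 : CubicalMesh n) (s k : ℕ) : Submodule ℝ 𝒯.PiecewiseForm :=
  Submodule.pi Set.univ (fun _ => Q n s k)

/-- `u` and `w` have the same canonical `Q_r^- Λ^k(𝒯)` degrees of freedom: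
`∫_f tr_f w ∧ v = ∫_f tr_f u ∧ v` for every face `f` of the mesh of dimension `l ≥ k` and every
`v ∈ Q_{r-1}^- Λ^{l-k}(f)`. -/
def SameDOF (𝒯 : CubicalMesh n) (r k : ℕ) (u w : 𝒯.PiecewiseForm) : Prop :=
  ∀ (T : {T // T ∈ 𝒯.cells}) (f : Cell n), f.IsFace T.1 → k ≤ f.dim →
    ∀ v ∈ QMinusOn f.free (r - 1) (f.dim - k),
      f.integral (wedge (f.tr (w T)) v) = f.integral (wedge (f.tr (u T)) v)

/-- The quadrature inner product `⟨u, v⟩_h = ∑_T ⟨u|_T, v|_T⟩_{h,T}` on `k`-forms. -/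
def quadInner (𝒯 : CubicalMesh n) (r k : ℕ) (u v : 𝒯.PiecewiseForm) : ℝ :=
  ∑ T : {T // T ∈ 𝒯.cells}, quadInnerOn r k T.1 (u T) (v T)

end CubicalMesh

end CubicalForms

end

/-! Everything factors over the coordinates. The canonical degrees of freedom of `Q_r^-` on a box
are tensor products of one-dimensional ones: in a direction `i ∈ σ` the moments against degree at
most `r - 1`, in a direction `i ∉ σ` the two endpoint values and the moments against degree at most
`r - 2`. So the projection acts on the coefficient of `dx_σ` as a tensor product of operators
`interp`, which exist by unisolvence on an interval (`eq_zero_of_dof_eq_zero`). Its trace on a face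
depends only on the trace of the form there (`tr_elementInterp`), so agreement of traces between
elements is preserved.

For the orthogonality, coefficients of forms in `Q̃_r` exceed the degrees of `Q_r^-` by at most one
in each variable (`mem_degreeBox_of_mem_QTilde`). It then suffices that, for such `p` and for `v` of
degree below `r`, replacing `p` by its interpolant does not change the one-dimensional Gauss–Lobatto
value of `p * v` (`glFunctional_interp_mul`); functionals that agree in each variable have the same
tensor product. If `i ∈ σ`, the rule is exact on `p * v`, and the moments agree. If `i ∉ σ`, the
degree may reach `2r`; but the interpolation error vanishes at the endpoints, so `v` matters only at
the interior nodes, the zeros of `L_r'`, and can be replaced by its remainder modulo `L_r'`. This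
has degree at most `r - 2`, and exactness and the moments apply again. -/

noncomputable section

namespace CubicalForms

open Polynomial

/-! ### Legendre polynomials and Gauss–Lobatto quadrature -/

/-- The integral of a polynomial over `[a, b]`, as a linear functional. -/
def polyInt (a b : ℝ) : ℝ[X] →ₗ[ℝ] ℝ where
  toFun p := ∫ t in a..b, p.eval t
  map_add' p q := by
    simp only [eval_add]
    exact intervalIntegral.integral_add (p.continuous.intervalIntegrable _ _)
      (q.continuous.intervalIntegrable _ _)
  map_smul' c p := by
    simp only [eval_smul, smul_eq_mul, RingHom.id_apply]
    exact intervalIntegral.integral_const_mul _ _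

theorem polyInt_apply (a b : ℝ) (p : ℝ[X]) : polyInt a b p = ∫ t in a..b, p.eval t := rfl

theorem polyInt_derivative (a b : ℝ) (p : ℝ[X]) :
    polyInt a b (derivative p) = p.eval b - p.eval a :=
  intervalIntegral.integral_eq_sub_of_hasDerivAt (fun t _ => p.hasDerivAt t)
    ((derivative p).continuous.intervalIntegrable _ _)

theorem polyInt_derivative_mul (a b : ℝ) (p q : ℝ[X]) :
    polyInt a b (derivative p * q) =
      (p * q).eval b - (p * q).eval a - polyInt a b (p * derivative q) := by
  rw [← polyInt_derivative, derivative_mul, map_add]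
  ring

/-- A polynomial that is nonnegative on `(a, b)` and has integral zero vanishes. -/
theorem eq_zero_of_polyInt_eq_zero {a b : ℝ} (hab : a < b) {g : ℝ[X]}
    (hg : ∀ t ∈ Set.Ioo a b, 0 ≤ g.eval t) (h : polyInt a b g = 0) : g = 0 := by
  have hcl : ∀ t ∈ Set.Icc a b, 0 ≤ g.eval t := by
    rw [← closure_Ioo hab.ne]
    exact fun t ht => closure_minimal hg (isClosed_le continuous_const g.continuous) ht
  have hz : ∀ t ∈ Set.Icc a b, g.eval t = 0 := by
    by_contra! hne
    obtain ⟨c, hc, hc'⟩ := hne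
    exact (intervalIntegral.integral_pos hab g.continuous.continuousOn
      (fun t ht => hcl t (Set.Ioc_subset_Icc_self ht))
      ⟨c, hc, lt_of_le_of_ne (hcl c hc) hc'.symm⟩).ne' h
  exact eq_zero_of_infinite_isRoot g
    ((Set.Icc_infinite hab).mono fun t ht => hz t ht)

theorem degree_iterate_derivative_bubble (r j : ℕ) (hj : j ≤ 2 * r) :
    (derivative^[j] ((X ^ 2 - 1 : ℝ[X]) ^ r)).degree = ((2 * r - j : ℕ) : WithBot ℕ) := by
  induction j with
  | zero =>
    have h : (X ^ 2 - 1 : ℝ[X]).degree = 2 := by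
      simpa using degree_X_pow_sub_C (n := 2) (by norm_num) (1 : ℝ)
    simp only [Function.iterate_zero, id, degree_pow, h]
    simp [mul_comm]
  | succ j ih =>
    have h := natDegree_eq_of_degree_eq_some (ih (by omega))
    rw [Function.iterate_succ_apply', degree_derivative (by omega), h]
    congr 1

/-- Rolle's theorem with multiplicities: each differentiation loses at most one of the `2r` real
roots. At `j = r + 1` this makes all roots of `L_r'` real. -/
theorem le_card_roots_iterate_derivative_bubble (r j : ℕ) :
    2 * r ≤ Multiset.card (derivative^[j] ((X ^ 2 - 1 : ℝ[X]) ^ r)).roots + j := by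
  induction j with
  | zero =>
    have h : (X ^ 2 - 1 : ℝ[X]) = (X - C 1) * (X - C (-1)) := by
      simp only [map_neg, map_one]; ring
    have h0 : ((X - C 1) * (X - C (-1)) : ℝ[X]) ≠ 0 :=
      mul_ne_zero (X_sub_C_ne_zero _) (X_sub_C_ne_zero _)
    rw [Function.iterate_zero, id, roots_pow, h, roots_mul h0, roots_X_sub_C, roots_X_sub_C]
    simp; omega
  | succ j ih =>
    rw [Function.iterate_succ_apply']
    have := card_roots_le_derivative (derivative^[j] ((X ^ 2 - 1 : ℝ[X]) ^ r))
    omega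

theorem eval_iterate_derivative_bubble (r j : ℕ) (hj : j < r) (c : ℝ) (hc : c ^ 2 = 1) :
    (derivative^[j] ((X ^ 2 - 1 : ℝ[X]) ^ r)).eval c = 0 := by
  have h := pow_sub_dvd_iterate_derivative_of_pow_dvd (p := (X ^ 2 - 1 : ℝ[X]) ^ r) j dvd_rfl
  obtain ⟨s, hs⟩ := (dvd_pow_self (X ^ 2 - 1 : ℝ[X]) (by omega : r - j ≠ 0)).trans h
  rw [hs]
  simp [hc]

/-- Integrate by parts `j` times. The boundary terms vanish because `±1` are zeros of order `r` of
the bubble, and each step lowers the degree of `p`. -/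
theorem polyInt_iterate_derivative_bubble_mul (r j : ℕ) (hj : j ≤ r) (p : ℝ[X])
    (hp : p.degree < j) : polyInt (-1) 1 (derivative^[j] ((X ^ 2 - 1 : ℝ[X]) ^ r) * p) = 0 := by
  induction j generalizing p with
  | zero =>
    have : p = 0 := by
      rw [← degree_eq_bot]; exact WithBot.lt_coe_bot.1 (by simpa using hp)
    simp [this]
  | succ j ih =>
    have hd : (derivative p).degree < j := by
      rcases eq_or_ne p 0 with rfl | h0
      · simp
      · refine lt_of_lt_of_le (degree_derivative_lt h0) ?_
        rw [degree_eq_natDegree h0] at hp ⊢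
        have h1 : p.natDegree < j + 1 := by exact_mod_cast hp
        exact_mod_cast Nat.lt_succ_iff.1 h1
    rw [Function.iterate_succ_apply', polyInt_derivative_mul, ih (by omega) _ hd, eval_mul,
      eval_mul, eval_iterate_derivative_bubble r j hj 1 (by norm_num),
      eval_iterate_derivative_bubble r j hj (-1) (by norm_num)]
    simp

theorem polyInt_legendre_mul (r : ℕ) (p : ℝ[X]) (hp : p.degree < r) :
    polyInt (-1) 1 (legendre r * p) = 0 := by
  rw [legendre, mul_assoc, ← smul_eq_C_mul, map_smul,
    polyInt_iterate_derivative_bubble_mul r r le_rfl p hp, smul_zero]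

theorem degree_derivative_legendre {r : ℕ} (hr : 1 ≤ r) :
    (derivative (legendre r)).degree = ((r - 1 : ℕ) : WithBot ℕ) := by
  rw [legendre, derivative_C_mul, degree_C_mul (by positivity),
    ← Function.iterate_succ_apply' derivative, degree_iterate_derivative_bubble _ _ (by omega)]
  congr 1
  omega

theorem card_roots_derivative_legendre {r : ℕ} (hr : 1 ≤ r) :
    Multiset.card (derivative (legendre r)).roots = r - 1 := by
  refine le_antisymm ?_ ?_
  · rw [← natDegree_eq_of_degree_eq_some (degree_derivative_legendre hr)]
    exact card_roots' _
  · rw [legendre, derivative_C_mul, roots_C_mul _ (by positivity),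
      ← Function.iterate_succ_apply' derivative]
    have := le_card_roots_iterate_derivative_bubble r r.succ
    omega

theorem derivative_legendre_ne_zero {r : ℕ} (hr : 1 ≤ r) : derivative (legendre r) ≠ 0 := by
  rw [← degree_ne_bot, degree_derivative_legendre hr]
  exact WithBot.coe_ne_bot

/-- One integration by parts, with boundary terms killed by `X ^ 2 - 1`, leaves `L_r` against a
polynomial of degree below `r`. Thus `L_r'` is an orthogonal polynomial for the weight `1 - x²`. -/
theorem polyInt_bubble_derivative_legendre_mul {r : ℕ} (p : ℝ[X])
    (hp : p.degree < (r - 1 : ℕ)) :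
    polyInt (-1) 1 ((X ^ 2 - 1) * derivative (legendre r) * p) = 0 := by
  have h : (X ^ 2 - 1) * derivative (legendre r) * p
      = derivative (legendre r) * ((X ^ 2 - 1) * p) := by ring
  rw [h, polyInt_derivative_mul, polyInt_legendre_mul]
  · simp
  · rcases eq_or_ne p 0 with rfl | h0
    · simp
    have hn := (natDegree_lt_iff_degree_lt h0).2 hp
    have h2 : (X ^ 2 - 1 : ℝ[X]).natDegree = 2 := by
      simpa using natDegree_X_pow_sub_C (n := 2) (r := (1 : ℝ))
    refine lt_of_le_of_lt degree_le_natDegree ?_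
    have := natDegree_derivative_le ((X ^ 2 - 1) * p)
    have := natDegree_mul_le (p := (X ^ 2 - 1 : ℝ[X])) (q := p)
    exact_mod_cast (by omega : (derivative ((X ^ 2 - 1) * p)).natDegree < r)

theorem bubble_neg {t : ℝ} (ht : t ∈ Set.Ioo (-1 : ℝ) 1) : t ^ 2 - 1 < 0 := by
  nlinarith [ht.1, ht.2]

/-- A factor of the derivative of a Legendre polynomial that has a constant sign on `(-1, 1)` is
constant. -/
theorem degree_le_of_derivative_legendre_eq_mul {r : ℕ} (hr : 1 ≤ r) {a s : ℝ[X]}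
    (h : derivative (legendre r) = a * s) (ε : ℝ) (hε : ε ≠ 0)
    (ha : ∀ t ∈ Set.Ioo (-1 : ℝ) 1, 0 ≤ ε * a.eval t) : a.degree ≤ 0 := by
  by_contra! hd
  have hne : a * s ≠ 0 := h ▸ derivative_legendre_ne_zero hr
  have hs : s.degree < (r - 1 : ℕ) := by
    rw [← degree_derivative_legendre hr, h, degree_mul]
    have hs0 := right_ne_zero_of_mul hne
    have ha0 := left_ne_zero_of_mul hne
    rw [degree_eq_natDegree hs0, degree_eq_natDegree ha0] at *
    have : 0 < a.natDegree := by exact_mod_cast hd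
    exact_mod_cast (by omega : s.natDegree < a.natDegree + s.natDegree)
  -- If `a` were nonconstant, the cofactor `s` would have degree below `r - 1`, hence be orthogonal
  -- to `L_r' = a * s`; but the weighted integrand contains `a * s²`, which has constant sign.
  have h0 := polyInt_bubble_derivative_legendre_mul s hs
  have := eq_zero_of_polyInt_eq_zero (a := -1) (b := 1) (by norm_num)
    (g := (-ε) • ((X ^ 2 - 1) * derivative (legendre r) * s))
    (fun t ht => by
      have h1 := mul_nonneg (mul_nonneg (ha t ht) (neg_nonneg.2 (bubble_neg ht).le))
        (sq_nonneg (s.eval t))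
      simp only [h, eval_smul, eval_mul, eval_sub, eval_pow, eval_X, eval_one, smul_eq_mul]
      linarith) (by rw [map_smul, h0, smul_zero])
  refine hne ?_
  rw [smul_eq_zero] at this
  rcases this with h1 | h1
  · simp [hε] at h1
  · have h2 : (X ^ 2 - 1 : ℝ[X]) ≠ 0 := (monic_X_pow_sub_C (1 : ℝ) two_ne_zero).ne_zero
    simp only [mul_eq_zero, h2, false_or, h] at h1 ⊢
    tauto

theorem mem_Ioo_of_isRoot_derivative_legendre {r : ℕ} (hr : 1 ≤ r) {c : ℝ}
    (hc : (derivative (legendre r)).IsRoot c) : c ∈ Set.Ioo (-1 : ℝ) 1 := by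
  obtain ⟨s, hs⟩ := dvd_iff_isRoot.2 hc
  by_contra hcI
  have : ∃ ε : ℝ, ε ≠ 0 ∧ ∀ t ∈ Set.Ioo (-1 : ℝ) 1, 0 ≤ ε * (X - C c).eval t := by
    rw [Set.mem_Ioo, not_and_or, not_lt, not_lt] at hcI
    rcases hcI with h | h
    · exact ⟨1, one_ne_zero, fun t ht => by simp; linarith [ht.1]⟩
    · exact ⟨-1, by norm_num, fun t ht => by simp; linarith [ht.2]⟩
  obtain ⟨ε, hε, h⟩ := this
  have := degree_le_of_derivative_legendre_eq_mul hr hs ε hε h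
  rw [degree_X_sub_C] at this
  exact absurd this (by decide)

theorem nodup_roots_derivative_legendre {r : ℕ} (hr : 1 ≤ r) :
    (derivative (legendre r)).roots.Nodup := by
  rw [Multiset.nodup_iff_count_le_one]
  intro c
  by_contra! hc
  rw [count_roots] at hc
  obtain ⟨s, hs⟩ := (pow_dvd_pow (X - C c) hc).trans (pow_rootMultiplicity_dvd _ c)
  have := degree_le_of_derivative_legendre_eq_mul hr hs 1 one_ne_zero
    (fun t _ => by simpa using sq_nonneg (t - c))
  simp only [degree_pow, degree_X_sub_C] at this
  exact absurd this (by decide)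

theorem card_glNodes {r : ℕ} (hr : 1 ≤ r) : (glNodes r).card = r + 1 := by
  have key : ∀ c : ℝ, c ∉ Set.Ioo (-1 : ℝ) 1 →
      c ∉ (derivative (legendre r)).roots.toFinset := fun c hc h =>
    hc (mem_Ioo_of_isRoot_derivative_legendre hr
      (isRoot_of_mem_roots (Multiset.mem_toFinset.1 h)))
  rw [glNodes, Finset.card_insert_of_notMem, Finset.card_insert_of_notMem (key _ (by simp)),
    Multiset.toFinset_card_of_nodup (nodup_roots_derivative_legendre hr),
    card_roots_derivative_legendre hr]
  · omega
  · rw [Finset.mem_insert, not_or]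
    exact ⟨by norm_num, key _ (by simp)⟩

theorem mem_glNodes {r : ℕ} (hr : 1 ≤ r) {ξ : ℝ} :
    ξ ∈ glNodes r ↔ ((X ^ 2 - 1) * derivative (legendre r)).eval ξ = 0 := by
  have h : ξ ^ 2 - 1 = 0 ↔ ξ = -1 ∨ ξ = 1 := by
    rw [sub_eq_zero, sq_eq_one_iff, or_comm]
  simp [glNodes, derivative_legendre_ne_zero hr, h]
  tauto

/-- The Gauss–Lobatto rule with `r + 1` points is exact in degree `2r - 1`. -/
theorem sum_glWeight_mul_eval {r : ℕ} (hr : 1 ≤ r) (p : ℝ[X]) (hp : p.degree < (2 * r : ℕ)) :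
    ∑ ξ ∈ glNodes r, glWeight r ξ * p.eval ξ = polyInt (-1) 1 p := by
  -- Divide `p` by the nodal polynomial `N`. The quotient has degree below `r - 1`, so `N * (p / N)`
  -- has integral zero by orthogonality and also vanishes at the nodes; the remainder has degree at
  -- most `r` and equals its Lagrange interpolant.
  set N : ℝ[X] := (X ^ 2 - 1) * derivative (legendre r) with hN
  have hNd : N.degree = (r + 1 : ℕ) := by
    have h : (X ^ 2 - 1 : ℝ[X]).degree = 2 := by
      simpa using degree_X_pow_sub_C (n := 2) (by norm_num) (1 : ℝ)
    rw [hN, degree_mul, h, degree_derivative_legendre hr]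
    exact_mod_cast (by omega : 2 + (r - 1) = r + 1)
  have hN0 : N ≠ 0 := by rw [← degree_ne_bot, hNd]; exact WithBot.coe_ne_bot
  have hdiv : polyInt (-1) 1 (N * (p / N)) = 0 := by
    apply polyInt_bubble_derivative_legendre_mul
    rcases eq_or_ne p 0 with rfl | h0
    · simp
    rcases lt_or_ge p.degree N.degree with hlt | hge
    · rw [(Polynomial.div_eq_zero_iff hN0).2 hlt]; simp
    · have h1 := degree_add_div hN0 hge
      rw [hNd] at h1
      have h2 : p / N ≠ 0 := fun h => by
        rw [h] at h1; rw [degree_zero, WithBot.add_bot] at h1; exact h0 (degree_eq_bot.1 h1.symm)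
      rw [← h1, degree_eq_natDegree h2] at hp
      rw [degree_eq_natDegree h2]
      have h3 : r + 1 + (p / N).natDegree < 2 * r := by exact_mod_cast hp
      exact_mod_cast (by omega : (p / N).natDegree < r - 1)
  have hmod : (p % N).degree < (glNodes r).card := by
    rw [card_glNodes hr, ← hNd]; exact EuclideanDomain.mod_lt _ hN0
  have heval : ∀ ξ ∈ glNodes r, p.eval ξ = (p % N).eval ξ := fun ξ hξ => by
    conv_lhs => rw [← EuclideanDomain.div_add_mod p N]
    rw [eval_add, eval_mul, (mem_glNodes hr).1 hξ]; simp
  conv_rhs => rw [← EuclideanDomain.div_add_mod p N, map_add, hdiv, zero_add,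
    Lagrange.eq_interpolate (Set.injOn_id _) hmod, Lagrange.interpolate_apply, map_sum]
  refine Finset.sum_congr rfl fun ξ hξ => ?_
  rw [← smul_eq_C_mul, map_smul, heval ξ hξ, smul_eq_mul, mul_comm]
  rfl

/-- The affine map from `[-1, 1]` onto `[a, b]`, as a polynomial. -/
def affinePoly (a b : ℝ) : ℝ[X] := C ((a + b) / 2) + C ((b - a) / 2) * X

theorem degree_comp_affine_lt (c d : ℝ) {p : ℝ[X]} {N : ℕ} (hp : p.degree < N) :
    (p.comp (C c + C d * X)).degree < N := by
  rcases eq_or_ne p 0 with rfl | h0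
  · simp
  have h1 : (C c + C d * X : ℝ[X]).natDegree ≤ 1 := by
    rw [add_comm]; exact natDegree_linear_le
  have hn := (natDegree_lt_iff_degree_lt h0).2 hp
  refine lt_of_le_of_lt degree_le_natDegree ?_
  have h2 : (p.comp (C c + C d * X)).natDegree ≤ p.natDegree * 1 := by
    rw [natDegree_comp]; exact Nat.mul_le_mul_left _ h1
  exact_mod_cast (by omega : (p.comp (C c + C d * X)).natDegree < N)

theorem polyInt_comp_affinePoly (a b : ℝ) (p : ℝ[X]) :
    (b - a) / 2 * polyInt (-1) 1 (p.comp (affinePoly a b)) = polyInt a b p := by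
  simp only [polyInt_apply, affinePoly, eval_comp, eval_add, eval_mul, eval_C, eval_X]
  rw [← smul_eq_mul, intervalIntegral.smul_integral_comp_add_mul (fun t => p.eval t)]
  congr 1 <;> ring

/-- The Gauss–Lobatto rule scaled to `[a, b]` and normalized to total mass one. -/
def glFunctional (r : ℕ) (a b : ℝ) : ℝ[X] →ₗ[ℝ] ℝ :=
  ∑ ξ ∈ glNodes r, (glWeight r ξ / 2) • leval ((a + b) / 2 + (b - a) / 2 * ξ)

theorem glFunctional_apply (r : ℕ) (a b : ℝ) (p : ℝ[X]) :
    glFunctional r a b p =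
      ∑ ξ ∈ glNodes r, glWeight r ξ / 2 * p.eval ((a + b) / 2 + (b - a) / 2 * ξ) := by
  simp [glFunctional, LinearMap.sum_apply]

theorem glFunctional_eq_comp (r : ℕ) (a b : ℝ) (p : ℝ[X]) :
    glFunctional r a b p =
      (∑ ξ ∈ glNodes r, glWeight r ξ * (p.comp (affinePoly a b)).eval ξ) / 2 := by
  rw [glFunctional_apply, Finset.sum_div]
  refine Finset.sum_congr rfl fun ξ _ => ?_
  simp [affinePoly]; ring

theorem glFunctional_eq_polyInt {r : ℕ} (hr : 1 ≤ r) {a b : ℝ} (hab : a < b) (p : ℝ[X])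
    (hp : p.degree < (2 * r : ℕ)) : glFunctional r a b p = (b - a)⁻¹ * polyInt a b p := by
  have hd : (p.comp (affinePoly a b)).degree < (2 * r : ℕ) := degree_comp_affine_lt _ _ hp
  rw [glFunctional_eq_comp, sum_glWeight_mul_eval hr _ hd, ← polyInt_comp_affinePoly a b]
  have : b - a ≠ 0 := (sub_pos.2 hab).ne'
  field_simp

end CubicalForms
end

/-! ### Canonical interpolation on an interval -/

noncomputable section

namespace CubicalForms

open Polynomial

/-- The one-dimensional degrees of freedom on `[a, b]`: the values at `a` and at `b`, and the
moments `p ↦ ∫ p tᵐ`. -/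
def dof (a b : ℝ) : Bool ⊕ ℕ → (ℝ[X] →ₗ[ℝ] ℝ)
  | .inl false => leval a
  | .inl true => leval b
  | .inr m => polyInt a b ∘ₗ LinearMap.mulRight ℝ (X ^ m)

/-- The degrees of freedom of `Q_r^- Λ¹` (if `s` is true) or `Q_r^- Λ⁰` (if `s` is false) on an
interval. -/
def dofSet (r : ℕ) (s : Bool) : Finset (Bool ⊕ ℕ) :=
  if s then Finset.disjSum ∅ (Finset.range r) else Finset.disjSum Finset.univ (Finset.range (r - 1))

/-- The dimension of `Q_r^- Λ¹` (if `s` is true) or `Q_r^- Λ⁰` (if `s` is false) on an interval. -/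
def shapeDim (r : ℕ) (s : Bool) : ℕ := if s then r else r + 1

theorem card_dofSet {r : ℕ} (hr : 1 ≤ r) (s : Bool) : (dofSet r s).card = shapeDim r s := by
  cases s
  · simp [dofSet, shapeDim]; omega
  · simp [dofSet, shapeDim]

theorem polyInt_mul_eq_zero {a b : ℝ} {N : ℕ} {p q : ℝ[X]}
    (h : ∀ m < N, dof a b (.inr m) p = 0) (hq : q.degree < N) : polyInt a b (p * q) = 0 := by
  rcases eq_or_ne q 0 with rfl | h0
  · simp
  rw [q.as_sum_range' N ((natDegree_lt_iff_degree_lt h0).2 hq), Finset.mul_sum, map_sum]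
  refine Finset.sum_eq_zero fun m hm => ?_
  rw [← C_mul_X_pow_eq_monomial, ← smul_eq_C_mul, mul_smul_comm, map_smul]
  have := h m (Finset.mem_range.1 hm)
  simp only [dof, LinearMap.comp_apply, LinearMap.mulRight_apply] at this
  rw [this, smul_zero]

/-- Unisolvence. With endpoint conditions, `p = (X - a) * (X - b) * s` and `s` is an admissible test
polynomial, so the integral of `(x - a) * (b - x) * s²` vanishes. Without them, `p` itself is an
admissible test polynomial. -/
theorem eq_zero_of_dof_eq_zero {r : ℕ} (hr : 1 ≤ r) {a b : ℝ} (hab : a < b) (s : Bool)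
    {p : ℝ[X]} (hp : p.degree < shapeDim r s) (h : ∀ j ∈ dofSet r s, dof a b j p = 0) :
    p = 0 := by
  cases s
  · have ha : p.eval a = 0 := h (.inl false) (by simp [dofSet])
    have hb : p.eval b = 0 := h (.inl true) (by simp [dofSet])
    obtain ⟨q, hq⟩ := dvd_iff_isRoot.2 ha
    have hb' : q.eval b = 0 := by
      rw [hq, eval_mul] at hb
      refine (mul_eq_zero.1 hb).resolve_left ?_
      simpa using (sub_pos.2 hab).ne'
    obtain ⟨s, hs⟩ := dvd_iff_isRoot.2 hb'
    rw [hs] at hq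
    have hsd : s.degree < (r - 1 : ℕ) := by
      rcases eq_or_ne s 0 with rfl | h0
      · simp
      rw [hq, degree_mul, degree_mul, degree_X_sub_C, degree_X_sub_C, degree_eq_natDegree h0] at hp
      rw [degree_eq_natDegree h0]
      have h1 : 1 + (1 + s.natDegree) < r + 1 := by simp only [shapeDim] at hp; exact_mod_cast hp
      exact_mod_cast (by omega : s.natDegree < r - 1)
    have hi := polyInt_mul_eq_zero (p := p) (q := s) (a := a) (b := b)
      (fun m hm => h (.inr m) (by simpa [dofSet] using hm)) hsd
    have := eq_zero_of_polyInt_eq_zero hab (g := -(p * s)) (fun t ht => by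
      rw [hq]
      simp only [eval_neg, eval_mul, eval_sub, eval_X, eval_C]
      have := mul_nonneg (mul_nonneg (sub_pos.2 ht.1).le (sub_pos.2 ht.2).le)
        (sq_nonneg (s.eval t))
      linarith) (by rw [map_neg, hi, neg_zero])
    rw [neg_eq_zero, mul_eq_zero] at this
    rcases this with h1 | h1
    · exact h1
    · rw [hq, h1]; simp
  · have hi := polyInt_mul_eq_zero (p := p) (q := p) (a := a) (b := b) (N := r)
      (fun m hm => h (.inr m) (by simpa [dofSet] using hm)) hp
    have := eq_zero_of_polyInt_eq_zero hab (g := p * p) (fun t ht => by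
      rw [eval_mul]; exact mul_self_nonneg _) hi
    exact mul_self_eq_zero.1 this

/-- `φ` is the basis of the one-dimensional shape functions dual to the degrees of freedom. -/
def IsDualBasis (r : ℕ) (s : Bool) (a b : ℝ) (φ : Bool ⊕ ℕ → ℝ[X]) : Prop :=
  ∀ j ∈ dofSet r s, (φ j).degree < shapeDim r s ∧
    ∀ i ∈ dofSet r s, dof a b i (φ j) = if i = j then 1 else 0

/-- There are as many degrees of freedom as dimensions, so unisolvence makes the evaluation map
bijective. -/
theorem exists_isDualBasis {r : ℕ} (hr : 1 ≤ r) {a b : ℝ} (hab : a < b) (s : Bool) :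
    ∃ φ, IsDualBasis r s a b φ := by
  let F : degreeLT ℝ (shapeDim r s) →ₗ[ℝ] (dofSet r s → ℝ) :=
    LinearMap.pi (fun j => dof a b j) ∘ₗ Submodule.subtype _
  have hinj : Function.Injective F := by
    rw [← LinearMap.ker_eq_bot, LinearMap.ker_eq_bot']
    intro p hp
    exact Subtype.ext (eq_zero_of_dof_eq_zero hr hab s (mem_degreeLT.1 p.2)
      fun j hj => congrFun hp ⟨j, hj⟩)
  have hfin : Module.finrank ℝ (degreeLT ℝ (shapeDim r s)) =
      Module.finrank ℝ (dofSet r s → ℝ) := by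
    rw [(degreeLTEquiv ℝ _).finrank_eq]
    simp [card_dofSet hr]
  have : FiniteDimensional ℝ (degreeLT ℝ (shapeDim r s)) :=
    (degreeLTEquiv ℝ _).symm.finiteDimensional
  have hsurj := (LinearMap.injective_iff_surjective_of_finrank_eq_finrank hfin).1 hinj
  choose ψ hψ using fun j : dofSet r s => hsurj (Pi.single j 1)
  refine ⟨fun j => if hj : j ∈ dofSet r s then ψ ⟨j, hj⟩ else 0, fun j hj => ?_⟩
  simp only [hj, dif_pos]
  refine ⟨mem_degreeLT.1 (ψ ⟨j, hj⟩).2, fun i hi => ?_⟩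
  have := congrFun (hψ ⟨j, hj⟩) ⟨i, hi⟩
  simpa [F, Pi.single_apply] using this

/-- The basis of the one-dimensional shape functions dual to the degrees of freedom. -/
def dualBasis (r : ℕ) (s : Bool) (a b : ℝ) : Bool ⊕ ℕ → ℝ[X] :=
  -- This choice needs no proof of existence, so the operator is defined for all `a`, `b`, `r`; its
  -- properties are claimed only for `a < b` and `1 ≤ r`.
  Classical.epsilon (IsDualBasis r s a b)

theorem isDualBasis_dualBasis {r : ℕ} (hr : 1 ≤ r) {a b : ℝ} (hab : a < b) (s : Bool) :
    IsDualBasis r s a b (dualBasis r s a b) :=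
  Classical.epsilon_spec (exists_isDualBasis hr hab s)

/-- The one-dimensional canonical interpolation operator. -/
def interp (r : ℕ) (s : Bool) (a b : ℝ) : ℝ[X] →ₗ[ℝ] ℝ[X] :=
  ∑ j ∈ dofSet r s, (dof a b j).smulRight (dualBasis r s a b j)

theorem interp_apply (r : ℕ) (s : Bool) (a b : ℝ) (p : ℝ[X]) :
    interp r s a b p = ∑ j ∈ dofSet r s, dof a b j p • dualBasis r s a b j := by
  simp [interp, LinearMap.sum_apply]

variable {r : ℕ} {a b : ℝ}

theorem degree_interp_lt (hr : 1 ≤ r) (hab : a < b) (s : Bool) (p : ℝ[X]) :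
    (interp r s a b p).degree < shapeDim r s := by
  rw [← mem_degreeLT, interp_apply]
  exact Submodule.sum_mem _ fun j hj => Submodule.smul_mem _ _
    (mem_degreeLT.2 (isDualBasis_dualBasis hr hab s j hj).1)

theorem dof_interp (hr : 1 ≤ r) (hab : a < b) (s : Bool) {i : Bool ⊕ ℕ} (hi : i ∈ dofSet r s)
    (p : ℝ[X]) : dof a b i (interp r s a b p) = dof a b i p := by
  rw [interp_apply, map_sum, Finset.sum_eq_single i]
  · simp [(isDualBasis_dualBasis hr hab s i hi).2 i hi]
  · intro j hj hji
    simp [(isDualBasis_dualBasis hr hab s j hj).2 i hi, hji.symm]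
  · exact fun h => absurd hi h

theorem interp_eq_self (hr : 1 ≤ r) (hab : a < b) (s : Bool) {p : ℝ[X]}
    (hp : p.degree < shapeDim r s) : interp r s a b p = p := by
  rw [← sub_eq_zero]
  refine eq_zero_of_dof_eq_zero hr hab s ?_ fun j hj => ?_
  · exact lt_of_le_of_lt (degree_sub_le _ _) (max_lt (degree_interp_lt hr hab s p) hp)
  · rw [map_sub, dof_interp hr hab s hj, sub_self]

theorem polyInt_interp_mul (hr : 1 ≤ r) (hab : a < b) (s : Bool) (p : ℝ[X]) {q : ℝ[X]}
    (hq : q.degree < (if s then r else r - 1 : ℕ)) :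
    polyInt a b (interp r s a b p * q) = polyInt a b (p * q) := by
  rw [← sub_eq_zero, ← map_sub, ← sub_mul]
  refine polyInt_mul_eq_zero (fun m hm => ?_) hq
  rw [map_sub, dof_interp hr hab, sub_self]
  cases s <;> simpa [dofSet] using hm

theorem degree_mul_lt {p q : ℝ[X]} {M N : ℕ} (hp : p.degree < M) (hq : q.degree < N) :
    (p * q).degree < (M + N - 1 : ℕ) := by
  rcases eq_or_ne p 0 with rfl | hp0
  · simp
  rcases eq_or_ne q 0 with rfl | hq0
  · simp
  rw [degree_mul, degree_eq_natDegree hp0, degree_eq_natDegree hq0] at *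
  have h1 : p.natDegree < M := by exact_mod_cast hp
  have h2 : q.natDegree < N := by exact_mod_cast hq
  exact_mod_cast (by omega : p.natDegree + q.natDegree < M + N - 1)

/-- The quadrature error of the interpolation vanishes against polynomials of degree `< r`, for
polynomials of one degree more than the shape functions. -/
theorem glFunctional_interp_mul (hr : 1 ≤ r) (hab : a < b) (s : Bool) {p v : ℝ[X]}
    (hp : p.degree < (shapeDim r s + 1 : ℕ)) (hv : v.degree < r) :
    glFunctional r a b (interp r s a b p * v) = glFunctional r a b (p * v) := by
  have hI := degree_interp_lt hr hab s p
  cases s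
  · set e := interp r false a b p - p with he
    rw [← sub_eq_zero, ← map_sub, ← sub_mul, ← he]
    have hed : e.degree < (r + 2 : ℕ) := by
      refine lt_of_le_of_lt (degree_sub_le _ _) (max_lt (hI.trans ?_) hp)
      simp only [shapeDim]
      exact_mod_cast (by simp)
    have hea : e.eval a = 0 := by
      have := dof_interp hr hab false (i := .inl false) (by simp [dofSet]) p
      simp only [dof, leval_apply] at this
      simp [he, this]
    have heb : e.eval b = 0 := by
      have := dof_interp hr hab false (i := .inl true) (by simp [dofSet]) p
      simp only [dof, leval_apply] at this
      simp [he, this]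
    have h2 : (b - a) / 2 ≠ 0 := (div_pos (sub_pos.2 hab) two_pos).ne'
    set D := derivative (legendre r) with hD
    -- On the reference interval, `w` agrees with `v` at the zeros of `L_r'` and has degree below `r
    -- - 1`; `q` is `w` transported back to `[a, b]` by the inverse affine map.
    set w := v.comp (affinePoly a b) % D with hw
    set q := w.comp (C (-((b - a) / 2)⁻¹ * ((a + b) / 2)) + C (((b - a) / 2)⁻¹) * X) with hqdef
    have hq : q.degree < (r - 1 : ℕ) := by
      refine degree_comp_affine_lt _ _ ?_
      rw [← degree_derivative_legendre hr]
      exact EuclideanDomain.mod_lt _ (derivative_legendre_ne_zero hr)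
    have hqw : q.comp (affinePoly a b) = w := by
      refine Polynomial.funext fun t => ?_
      rw [hqdef]
      simp only [eval_comp, affinePoly, eval_add, eval_mul, eval_C, eval_X]
      congr 1
      rw [mul_add, inv_mul_cancel_left₀ h2]
      ring
    have hsame : glFunctional r a b (e * v) = glFunctional r a b (e * q) := by
      rw [glFunctional_eq_comp, glFunctional_eq_comp]
      congr 1
      refine Finset.sum_congr rfl fun ξ hξ => ?_
      rw [mul_comp, mul_comp, hqw, eval_mul, eval_mul]
      rw [mem_glNodes hr, eval_mul, mul_eq_zero] at hξ
      -- At the end nodes the error `e` vanishes; at the interior nodes `v` and `q` agree.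
      rcases hξ with hξ | hξ
      · have : (e.comp (affinePoly a b)).eval ξ = 0 := by
          have : ξ = 1 ∨ ξ = -1 := by
            simpa [sub_eq_zero] using hξ
          rw [eval_comp]
          rcases this with rfl | rfl
          · rwa [show (affinePoly a b).eval 1 = b by simp [affinePoly]; ring]
          · rwa [show (affinePoly a b).eval (-1) = a by simp [affinePoly]; ring]
        rw [this, zero_mul, zero_mul]
      · congr 2
        conv_lhs => rw [← EuclideanDomain.div_add_mod (v.comp (affinePoly a b)) D]
        rw [eval_add, eval_mul, hξ, zero_mul, zero_add]
    rw [hsame, glFunctional_eq_polyInt hr hab, he, sub_mul, map_sub,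
      polyInt_interp_mul hr hab false p (by simpa using hq), sub_self, mul_zero]
    -- `e * q` has degree at most `(r + 1) + (r - 2) = 2r - 1`, the limit of exactness.
    refine (degree_mul_lt hed hq).trans_le ?_
    exact_mod_cast (by omega : r + 2 + (r - 1) - 1 ≤ 2 * r)
  · simp only [shapeDim, if_true] at hp hI
    rw [glFunctional_eq_polyInt hr hab, glFunctional_eq_polyInt hr hab,
      polyInt_interp_mul hr hab true p (by simpa using hv)]
    · refine (degree_mul_lt hp hv).trans_le ?_
      exact_mod_cast (by omega : r + 1 + r - 1 ≤ 2 * r)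
    · refine (degree_mul_lt hI hv).trans_le ?_
      exact_mod_cast (by omega : r + r - 1 ≤ 2 * r)

end CubicalForms
end

/-! ### Tensor products of one-dimensional operators and functionals -/

noncomputable section

namespace CubicalForms

section Tensor

variable {n : ℕ} {R : Type*} [CommRing R] [Algebra ℝ R]

/-- The linear map sending `∏ p_i(x_i)` to `∏ B_i(p_i)`. -/
def tensorLift (B : Fin n → (Polynomial ℝ →ₗ[ℝ] R)) : MvPolynomial (Fin n) ℝ →ₗ[ℝ] R :=
  (MvPolynomial.basisMonomials (Fin n) ℝ).constr ℝ fun α => ∏ i, B i (Polynomial.X ^ α i)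

theorem tensorLift_monomial (B : Fin n → (Polynomial ℝ →ₗ[ℝ] R)) (α : Fin n →₀ ℕ) :
    tensorLift B (MvPolynomial.monomial α 1) = ∏ i, B i (Polynomial.X ^ α i) := by
  have := (MvPolynomial.basisMonomials (Fin n) ℝ).constr_basis ℝ
    (fun α => ∏ i, B i (Polynomial.X ^ α i)) α
  rwa [MvPolynomial.coe_basisMonomials] at this

theorem linearMap_ext_monomial {M : Type*} [AddCommMonoid M] [Module ℝ M]
    {f g : MvPolynomial (Fin n) ℝ →ₗ[ℝ] M}
    (h : ∀ α, f (MvPolynomial.monomial α 1) = g (MvPolynomial.monomial α 1)) : f = g :=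
  (MvPolynomial.basisMonomials (Fin n) ℝ).ext fun α => by
    simpa only [MvPolynomial.coe_basisMonomials] using h α

theorem monomial_eq_prod (α : Fin n →₀ ℕ) :
    (MvPolynomial.monomial α (1 : ℝ)) = ∏ i, MvPolynomial.X i ^ α i := by
  rw [MvPolynomial.monomial_eq, MvPolynomial.C_1, one_mul, Finsupp.prod_fintype _ _ (by simp)]

/-- Both sides are multilinear in the family `p`, so it is enough to compare them on powers of `X`.
-/
theorem tensorLift_prod (B : Fin n → (Polynomial ℝ →ₗ[ℝ] R)) (p : Fin n → Polynomial ℝ) :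
    tensorLift B (∏ i, Polynomial.aeval (MvPolynomial.X i) (p i)) = ∏ i, B i (p i) := by
  let f : MultilinearMap ℝ (fun _ : Fin n => Polynomial ℝ) R :=
    (tensorLift B).compMultilinearMap
      ((MultilinearMap.mkPiAlgebra ℝ (Fin n) (MvPolynomial (Fin n) ℝ)).compLinearMap
        fun i => (Polynomial.aeval (MvPolynomial.X i)).toLinearMap)
  let g : MultilinearMap ℝ (fun _ : Fin n => Polynomial ℝ) R :=
    (MultilinearMap.mkPiAlgebra ℝ (Fin n) R).compLinearMap B
  have : f = g := by
    refine Module.Basis.ext_multilinear (fun _ => Polynomial.basisMonomials ℝ) fun v => ?_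
    simp only [f, g, LinearMap.compMultilinearMap_apply, MultilinearMap.compLinearMap_apply,
      MultilinearMap.mkPiAlgebra_apply, Polynomial.coe_basisMonomials, AlgHom.toLinearMap_apply,
      ← Polynomial.X_pow_eq_monomial, map_pow, Polynomial.aeval_X]
    have := tensorLift_monomial B (Finsupp.equivFunOnFinite.symm v)
    rwa [monomial_eq_prod] at this
  exact congrArg (fun F => F p) this

/-- The operator `∏ p_i(x_i) ↦ ∏ (A_i p_i)(x_i)`. -/
def tensorMap (A : Fin n → (Polynomial ℝ →ₗ[ℝ] Polynomial ℝ)) :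
    MvPolynomial (Fin n) ℝ →ₗ[ℝ] MvPolynomial (Fin n) ℝ :=
  tensorLift fun i => (Polynomial.aeval (MvPolynomial.X i)).toLinearMap ∘ₗ A i

theorem tensorMap_monomial (A : Fin n → (Polynomial ℝ →ₗ[ℝ] Polynomial ℝ)) (α : Fin n →₀ ℕ) :
    tensorMap A (MvPolynomial.monomial α 1) =
      ∏ i, Polynomial.aeval (MvPolynomial.X i) (A i (Polynomial.X ^ α i)) :=
  tensorLift_monomial _ _

theorem tensorLift_tensorMap (B : Fin n → (Polynomial ℝ →ₗ[ℝ] R))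
    (A : Fin n → (Polynomial ℝ →ₗ[ℝ] Polynomial ℝ)) (p : MvPolynomial (Fin n) ℝ) :
    tensorLift B (tensorMap A p) = tensorLift (fun i => B i ∘ₗ A i) p := by
  refine LinearMap.congr_fun (f := tensorLift B ∘ₗ tensorMap A)
    (linearMap_ext_monomial fun α => ?_) p
  rw [LinearMap.comp_apply, tensorMap_monomial, tensorLift_prod, tensorLift_monomial]
  rfl

theorem tensorMap_tensorMap (A' A : Fin n → (Polynomial ℝ →ₗ[ℝ] Polynomial ℝ))
    (p : MvPolynomial (Fin n) ℝ) :
    tensorMap A' (tensorMap A p) = tensorMap (fun i => A' i ∘ₗ A i) p :=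
  tensorLift_tensorMap _ _ _

/-- Puts multiplication by a test monomial in tensor form, so that moments and quadrature values of
products become composites of tensor operators. -/
theorem mul_monomial_eq_tensorMap (p : MvPolynomial (Fin n) ℝ) (β : Fin n →₀ ℕ) :
    p * MvPolynomial.monomial β 1 =
      tensorMap (fun i => LinearMap.mulRight ℝ (Polynomial.X ^ β i)) p := by
  refine LinearMap.congr_fun (f := LinearMap.mulRight ℝ (MvPolynomial.monomial β 1))
    (linearMap_ext_monomial fun α => ?_) p
  rw [tensorMap_monomial, LinearMap.mulRight_apply, monomial_eq_prod, monomial_eq_prod,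
    ← Finset.prod_mul_distrib]
  simp

/-- Polynomials of degree at most `N i` in `x_i`. -/
def degreeBox (N : Fin n → ℕ) : Submodule ℝ (MvPolynomial (Fin n) ℝ) :=
  Submodule.span ℝ {m | ∃ α : Fin n →₀ ℕ, (∀ i, α i ≤ N i) ∧ m = MvPolynomial.monomial α 1}

theorem monomial_mem_degreeBox {N : Fin n → ℕ} {α : Fin n →₀ ℕ} (h : ∀ i, α i ≤ N i) (c : ℝ) :
    MvPolynomial.monomial α c ∈ degreeBox N := by
  have : MvPolynomial.monomial α c = c • MvPolynomial.monomial α (1 : ℝ) := by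
    rw [MvPolynomial.smul_monomial, smul_eq_mul, mul_one]
  rw [this]
  exact Submodule.smul_mem _ _ (Submodule.subset_span ⟨α, h, rfl⟩)

theorem linearMap_congr_degreeBox {M : Type*} [AddCommMonoid M] [Module ℝ M] {N : Fin n → ℕ}
    {f g : MvPolynomial (Fin n) ℝ →ₗ[ℝ] M}
    (h : ∀ α : Fin n →₀ ℕ, (∀ i, α i ≤ N i) →
      f (MvPolynomial.monomial α 1) = g (MvPolynomial.monomial α 1))
    {p : MvPolynomial (Fin n) ℝ} (hp : p ∈ degreeBox N) : f p = g p :=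
  LinearMap.eqOn_span (s := {m | ∃ α : Fin n →₀ ℕ, (∀ i, α i ≤ N i) ∧
    m = MvPolynomial.monomial α 1}) (by rintro _ ⟨α, hα, rfl⟩; exact h α hα) hp

theorem tensorLift_congr {N : Fin n → ℕ} {B B' : Fin n → (Polynomial ℝ →ₗ[ℝ] R)}
    (h : ∀ i, ∀ m ≤ N i, B i (Polynomial.X ^ m) = B' i (Polynomial.X ^ m))
    {p : MvPolynomial (Fin n) ℝ} (hp : p ∈ degreeBox N) : tensorLift B p = tensorLift B' p :=
  linearMap_congr_degreeBox (fun α hα => by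
    rw [tensorLift_monomial, tensorLift_monomial]
    exact Finset.prod_congr rfl fun i _ => h i _ (hα i)) hp

theorem tensorMap_eq_self {N : Fin n → ℕ} {A : Fin n → (Polynomial ℝ →ₗ[ℝ] Polynomial ℝ)}
    (h : ∀ i, ∀ m ≤ N i, A i (Polynomial.X ^ m) = Polynomial.X ^ m)
    {p : MvPolynomial (Fin n) ℝ} (hp : p ∈ degreeBox N) : tensorMap A p = p :=
  linearMap_congr_degreeBox (g := LinearMap.id) (fun α hα => by
    rw [tensorMap_monomial, LinearMap.id_apply, monomial_eq_prod]
    exact Finset.prod_congr rfl fun i _ => by rw [h i _ (hα i)]; simp) hp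

theorem prod_aeval_mem_degreeBox {N : Fin n → ℕ} {p : Fin n → Polynomial ℝ}
    (h : ∀ i, (p i).degree < (N i + 1 : ℕ)) :
    ∏ i, Polynomial.aeval (MvPolynomial.X i) (p i) ∈ degreeBox N := by
  have hn : ∀ i, (p i).natDegree < N i + 1 := fun i => by
    rcases eq_or_ne (p i) 0 with h0 | h0
    · simp [h0]
    · exact (Polynomial.natDegree_lt_iff_degree_lt h0).2 (h i)
  have he : ∀ i, Polynomial.aeval (MvPolynomial.X i : MvPolynomial (Fin n) ℝ) (p i) =
      ∑ m ∈ Finset.range (N i + 1), (p i).coeff m • MvPolynomial.X i ^ m := fun i =>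
    Polynomial.aeval_eq_sum_range' (hn i) _
  simp_rw [he, Finset.prod_univ_sum, Finset.prod_smul]
  refine Submodule.sum_mem _ fun m hm => Submodule.smul_mem _ _ (Submodule.subset_span ?_)
  refine ⟨Finsupp.equivFunOnFinite.symm m, fun i => ?_, ?_⟩
  · exact Nat.lt_succ_iff.1 (Finset.mem_range.1 (Fintype.mem_piFinset.1 hm i))
  · rw [monomial_eq_prod]; rfl

theorem tensorMap_mem_degreeBox {N : Fin n → ℕ}
    {A : Fin n → (Polynomial ℝ →ₗ[ℝ] Polynomial ℝ)}
    (h : ∀ i p, (A i p).degree < (N i + 1 : ℕ)) (p : MvPolynomial (Fin n) ℝ) :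
    tensorMap A p ∈ degreeBox N := by
  rw [p.as_sum, map_sum]
  refine Submodule.sum_mem _ fun α _ => ?_
  have : MvPolynomial.monomial α (p.coeff α) = p.coeff α • MvPolynomial.monomial α (1 : ℝ) := by
    rw [MvPolynomial.smul_monomial, smul_eq_mul, mul_one]
  rw [this, map_smul, tensorMap_monomial]
  exact Submodule.smul_mem _ _ (prod_aeval_mem_degreeBox fun i => h i _)

end Tensor

end CubicalForms
end

/-! ### Canonical interpolation of forms on a box -/

noncomputable section

namespace CubicalForms

open MeasureTheory

variable {n : ℕ}

/-- The degree bounds of the `dx_σ` component of `Q_r^- Λ^k`. -/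
def minusBound (r : ℕ) (σ : Finset (Fin n)) (i : Fin n) : ℕ := shapeDim r (decide (i ∈ σ)) - 1

theorem shapeDim_pos {r : ℕ} (hr : 1 ≤ r) (s : Bool) : 0 < shapeDim r s := by
  cases s <;> simp [shapeDim]; omega

/-- The condition `cdeg_r = 0` bounds each exponent separately, by `r - 1` for `i ∈ σ` and by `r`
otherwise; hence the space splits into coefficient spaces of tensor product type. -/
theorem mem_QMinus_iff {r k : ℕ} (hr : 1 ≤ r) {u : PolyForm n} :
    u ∈ QMinus n r k ↔
      (∀ σ, σ.card ≠ k → u σ = 0) ∧ ∀ σ, u σ ∈ degreeBox (minusBound r σ) := by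
  constructor
  · intro hu
    refine Submodule.span_induction (p := fun u _ => (∀ σ, σ.card ≠ k → u σ = 0) ∧
      ∀ σ, u σ ∈ degreeBox (minusBound r σ)) ?_ ?_ ?_ ?_ hu
    · rintro _ ⟨α, τ, -, -, hτ, hα, hc, rfl⟩
      refine ⟨fun σ hσ => ?_, fun σ => ?_⟩
      · exact Pi.single_eq_of_ne (by rintro rfl; exact hσ hτ) _
      · rcases eq_or_ne σ τ with rfl | hne
        · rw [formMonomial, Pi.single_eq_same]
          refine monomial_mem_degreeBox (fun i => ?_) 1
          have h1 := hα i
          rw [cdeg, Finset.card_eq_zero, Finset.filter_eq_empty_iff] at hc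
          by_cases hi : i ∈ σ
          · have := hc hi
            simp [minusBound, shapeDim, hi]; omega
          · simpa [minusBound, shapeDim, hi] using h1
        · rw [formMonomial, Pi.single_eq_of_ne hne]
          exact Submodule.zero_mem _
    · exact ⟨fun _ _ => rfl, fun _ => Submodule.zero_mem _⟩
    · exact fun x y _ _ hx hy => ⟨fun σ hσ => by simp [hx.1 σ hσ, hy.1 σ hσ],
        fun σ => Submodule.add_mem _ (hx.2 σ) (hy.2 σ)⟩
    · exact fun c x _ hx => ⟨fun σ hσ => by simp [hx.1 σ hσ],
        fun σ => Submodule.smul_mem _ _ (hx.2 σ)⟩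
  · rintro ⟨h0, hb⟩
    rw [← Finset.univ_sum_single u]
    refine Submodule.sum_mem _ fun σ _ => ?_
    by_cases hσ : σ.card = k
    · have hle : (degreeBox (minusBound r σ)).map
          (LinearMap.single ℝ (fun _ : Finset (Fin n) => MvPolynomial (Fin n) ℝ) σ) ≤
            QMinus n r k := by
        rw [degreeBox, Submodule.map_span, Submodule.span_le]
        rintro _ ⟨_, ⟨α, hα, rfl⟩, rfl⟩
        refine Submodule.subset_span ⟨α, σ, Finset.subset_univ _, Finset.subset_univ _, hσ,
          fun i => ?_, ?_, rfl⟩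
        · have := hα i
          by_cases hi : i ∈ σ <;> simp [minusBound, shapeDim, hi] at this <;> omega
        · rw [cdeg, Finset.card_eq_zero, Finset.filter_eq_empty_iff]
          intro i hi
          have := hα i
          simp [minusBound, shapeDim, hi] at this
          omega
      exact hle ⟨u σ, hb σ, rfl⟩
    · rw [h0 σ hσ, Pi.single_zero]
      exact Submodule.zero_mem _

/-- The canonical interpolation of the coefficient of `dx_σ` on the box `T`. -/
def coeffInterp (r : ℕ) (T : BoxIntegral.Box (Fin n)) (σ : Finset (Fin n)) :
    MvPolynomial (Fin n) ℝ →ₗ[ℝ] MvPolynomial (Fin n) ℝ :=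
  tensorMap fun i => interp r (decide (i ∈ σ)) (T.lower i) (T.upper i)

/-- The canonical interpolation operator onto `Q_r^- Λ^k` on the box `T`. -/
def elementInterp (r k : ℕ) (T : BoxIntegral.Box (Fin n)) : PolyForm n →ₗ[ℝ] PolyForm n :=
  LinearMap.pi fun σ => if σ.card = k then coeffInterp r T σ ∘ₗ LinearMap.proj σ else 0

theorem elementInterp_apply_of_card_eq {r k : ℕ} (T : BoxIntegral.Box (Fin n)) (u : PolyForm n)
    {σ : Finset (Fin n)} (hσ : σ.card = k) :
    elementInterp r k T u σ = coeffInterp r T σ (u σ) := by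
  simp [elementInterp, hσ]

theorem elementInterp_apply_of_card_ne {r k : ℕ} (T : BoxIntegral.Box (Fin n)) (u : PolyForm n)
    {σ : Finset (Fin n)} (hσ : σ.card ≠ k) : elementInterp r k T u σ = 0 := by
  simp [elementInterp, hσ]

theorem elementInterp_mem_QMinus {r : ℕ} (hr : 1 ≤ r) (k : ℕ) (T : BoxIntegral.Box (Fin n))
    (u : PolyForm n) : elementInterp r k T u ∈ QMinus n r k := by
  rw [mem_QMinus_iff hr]
  refine ⟨fun σ hσ => elementInterp_apply_of_card_ne T u hσ, fun σ => ?_⟩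
  by_cases hσ : σ.card = k
  · rw [elementInterp_apply_of_card_eq T u hσ]
    refine tensorMap_mem_degreeBox (fun i p => ?_) _
    rw [minusBound, Nat.sub_add_cancel (shapeDim_pos hr _)]
    exact degree_interp_lt hr (T.lower_lt_upper i) _ p
  · rw [elementInterp_apply_of_card_ne T u hσ]
    exact Submodule.zero_mem _

theorem elementInterp_eq_self {r k : ℕ} (hr : 1 ≤ r) (T : BoxIntegral.Box (Fin n))
    {u : PolyForm n} (hu : u ∈ QMinus n r k) : elementInterp r k T u = u := by
  rw [mem_QMinus_iff hr] at hu
  funext σ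
  by_cases hσ : σ.card = k
  · rw [elementInterp_apply_of_card_eq T u hσ]
    refine tensorMap_eq_self (fun i m hm => interp_eq_self hr (T.lower_lt_upper i) _ ?_) (hu.2 σ)
    rw [Polynomial.degree_X_pow]
    have := shapeDim_pos hr (decide (i ∈ σ))
    rw [minusBound] at hm
    exact_mod_cast (by omega : m < shapeDim r (decide (i ∈ σ)))
  · rw [elementInterp_apply_of_card_ne T u hσ, hu.1 σ hσ]

/-- Shows that the interpolant depends only on the tensor product degrees of freedom, each of which
will be realized as a moment over a face. -/
theorem coeffInterp_eq_sum (r : ℕ) (T : BoxIntegral.Box (Fin n)) (σ : Finset (Fin n))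
    (p : MvPolynomial (Fin n) ℝ) :
    coeffInterp r T σ p = ∑ j ∈ Fintype.piFinset fun i => dofSet r (decide (i ∈ σ)),
      tensorLift (fun i => dof (T.lower i) (T.upper i) (j i)) p •
        ∏ i, Polynomial.aeval (MvPolynomial.X i)
          (dualBasis r (decide (i ∈ σ)) (T.lower i) (T.upper i) (j i)) := by
  refine (LinearMap.congr_fun (g := ∑ j ∈ Fintype.piFinset fun i => dofSet r (decide (i ∈ σ)),
      (tensorLift (fun i => dof (T.lower i) (T.upper i) (j i))).smulRight
        (∏ i, Polynomial.aeval (MvPolynomial.X i)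
          (dualBasis r (decide (i ∈ σ)) (T.lower i) (T.upper i) (j i))))
    (linearMap_ext_monomial fun α => ?_) p).trans (by simp [LinearMap.sum_apply])
  rw [coeffInterp, tensorMap_monomial]
  simp only [interp_apply, map_sum, map_smul, LinearMap.sum_apply, LinearMap.smulRight_apply,
    tensorLift_monomial, Finset.prod_univ_sum, Finset.prod_smul]

/-! ### Traces and moments on faces -/

section Faces

/-- The one-dimensional factors of the trace on `f`. -/
def traceFactor (f : Cell n) (i : Fin n) : Polynomial ℝ →ₗ[ℝ] Polynomial ℝ :=
  if i ∈ f.free then LinearMap.id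
  else Algebra.linearMap ℝ (Polynomial ℝ) ∘ₗ Polynomial.leval (f.lo i)

theorem tr_apply (f : Cell n) (u : PolyForm n) {σ : Finset (Fin n)} (hσ : σ ⊆ f.free) :
    f.tr u σ = tensorMap (traceFactor f) (u σ) := by
  rw [Cell.tr, if_pos hσ]
  refine LinearMap.congr_fun (f := (MvPolynomial.aeval (fun i => if i ∈ f.free then
    (MvPolynomial.X i : MvPolynomial (Fin n) ℝ) else MvPolynomial.C (f.lo i))).toLinearMap)
    (linearMap_ext_monomial fun α => ?_) (u σ)
  rw [tensorMap_monomial, AlgHom.toLinearMap_apply, monomial_eq_prod, map_prod]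
  refine Finset.prod_congr rfl fun i _ => ?_
  by_cases hi : i ∈ f.free
  · simp [traceFactor, hi]
  · simp [traceFactor, hi]

/-- The one-dimensional factors of the integral over `f`. -/
def integralFactor (f : Cell n) (i : Fin n) : Polynomial ℝ →ₗ[ℝ] ℝ :=
  if i ∈ f.free then polyInt (f.lo i) (f.hi i) else Polynomial.leval (f.lo i)

theorem continuous_eval_point (f : Cell n) (p : MvPolynomial (Fin n) ℝ) :
    Continuous fun y => MvPolynomial.eval (f.point y) p := by
  refine p.continuous_eval.comp (continuous_pi fun i => ?_)
  unfold Cell.point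
  split_ifs
  · exact continuous_apply _
  · exact continuous_const

/-- Fubini on monomials, with evaluation at the constant coordinate in the directions that are not
free. -/
theorem integral_eq_tensorLift (f : Cell n) (ω : PolyForm n) :
    f.integral ω = tensorLift (integralFactor f) (ω f.free) := by
  rw [Cell.integral]
  generalize ω f.free = p
  have hint : ∀ q : MvPolynomial (Fin n) ℝ, Integrable
      (fun y => MvPolynomial.eval (f.point y) q)
      (volume.restrict (Set.Icc (fun i : {i // i ∈ f.free} => f.lo i) fun i => f.hi i)) :=
    fun q => (continuous_eval_point f q).continuousOn.integrableOn_Icc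
  let I : MvPolynomial (Fin n) ℝ →ₗ[ℝ] ℝ :=
    { toFun := fun q => ∫ y in Set.Icc (fun i : {i // i ∈ f.free} => f.lo i) (fun i => f.hi i),
        MvPolynomial.eval (f.point y) q
      map_add' := fun q q' => by
        simp only [map_add]
        exact integral_add (hint q) (hint q')
      map_smul' := fun c q => by
        simp only [MvPolynomial.smul_eval, RingHom.id_apply, smul_eq_mul]
        exact integral_const_mul _ _ }
  refine LinearMap.congr_fun (f := I) (linearMap_ext_monomial fun α => ?_) p
  rw [tensorLift_monomial]
  change ∫ y in Set.Icc (fun i : {i // i ∈ f.free} => f.lo i) (fun i => f.hi i),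
        MvPolynomial.eval (f.point y) (MvPolynomial.monomial α 1) = _
  have hev : ∀ y, MvPolynomial.eval (f.point y) (MvPolynomial.monomial α (1 : ℝ)) =
      (∏ i : {i // i ∈ f.free}, y i ^ α i) * ∏ i ∈ f.freeᶜ, f.lo i ^ α i := fun y => by
    rw [monomial_eq_prod, map_prod, ← Finset.prod_mul_prod_compl f.free, ← Finset.prod_coe_sort]
    congr 1
    · exact Finset.prod_congr rfl fun i _ => by simp [Cell.point]
    · exact Finset.prod_congr rfl fun i hi => by
        simp [Cell.point, Finset.mem_compl.1 hi]
  simp_rw [hev]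
  rw [integral_mul_const, ← Set.pi_univ_Icc, volume_pi, Measure.restrict_pi_pi,
    integral_fintype_prod_eq_prod (fun (i : {i // i ∈ f.free}) (t : ℝ) => t ^ α i),
    ← Finset.prod_mul_prod_compl f.free (fun i => integralFactor f i (Polynomial.X ^ α i)),
    ← Finset.prod_coe_sort f.free]
  congr 1
  · refine Finset.prod_congr rfl fun i _ => ?_
    rw [integralFactor, if_pos i.2, polyInt_apply, intervalIntegral.integral_of_le (f.le i),
      integral_Icc_eq_integral_Ioc]
    simp
  · exact Finset.prod_congr rfl fun i hi => by
      simp [integralFactor, Finset.mem_compl.1 hi]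

theorem wedge_formMonomial (u : PolyForm n) (β : Fin n →₀ ℕ) {ρ τ : Finset (Fin n)}
    (hρ : ρ ⊆ τ) : wedge u (formMonomial β ρ) τ =
      shuffleSign (τ \ ρ) ρ • (u (τ \ ρ) * MvPolynomial.monomial β 1) := by
  rw [wedge, Finset.sum_eq_single (τ \ ρ)]
  · rw [Finset.sdiff_sdiff_eq_self hρ, formMonomial, Pi.single_eq_same]
  · intro σ hσ hne
    have : τ \ σ ≠ ρ := by
      rintro rfl
      exact hne (Finset.sdiff_sdiff_eq_self (Finset.mem_powerset.1 hσ)).symm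
    rw [formMonomial, Pi.single_eq_of_ne this, mul_zero, smul_zero]
  · intro h
    exact absurd (Finset.mem_powerset.2 Finset.sdiff_subset) h

theorem wedge_add_right (u v w : PolyForm n) : wedge u (v + w) = wedge u v + wedge u w := by
  funext τ
  simp [wedge, mul_add, Finset.sum_add_distrib]

theorem wedge_smul_right (c : ℝ) (u v : PolyForm n) : wedge u (c • v) = c • wedge u v := by
  funext τ
  simp only [wedge, Pi.smul_apply, Finset.smul_sum, mul_smul_comm]
  exact Finset.sum_congr rfl fun σ _ => smul_comm _ _ _

theorem wedge_zero_right (u : PolyForm n) : wedge u 0 = 0 := by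
  funext τ
  simp [wedge]

/-- The one-dimensional degrees of freedom that make up the moment against `x^β` over a face. -/
def faceDof (T : BoxIntegral.Box (Fin n)) (f : Cell n) (β : Fin n →₀ ℕ) (i : Fin n) : Bool ⊕ ℕ :=
  -- On a face of `T`, the flag is `false` at the lower end and `true` at the upper end, as in
  -- `dof`.
  if i ∈ f.free then .inr (β i) else .inl (decide (f.lo i ≠ T.lower i))

theorem Cell.IsFace.eq_of_mem_free {f : Cell n} {T : BoxIntegral.Box (Fin n)} (h : f.IsFace T)
    {i : Fin n} (hi : i ∈ f.free) : f.lo i = T.lower i ∧ f.hi i = T.upper i := by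
  have hlt : f.lo i < f.hi i := by simpa [Cell.free] using hi
  rcases h i with h | h | h
  · exact h
  · exact absurd (h.1.trans h.2.symm) hlt.ne
  · exact absurd (h.1.trans h.2.symm) hlt.ne

theorem Cell.IsFace.lo_eq_or {f : Cell n} {T : BoxIntegral.Box (Fin n)}
    (h : f.IsFace T) (i : Fin n) :
    f.lo i = T.lower i ∨ f.lo i = T.upper i := by
  rcases h i with h | h | h
  · exact .inl h.1
  · exact .inl h.1
  · exact .inr h.1

theorem dof_faceDof_of_notMem {f : Cell n} {T : BoxIntegral.Box (Fin n)} (h : f.IsFace T)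
    (β : Fin n →₀ ℕ) {i : Fin n} (hi : i ∉ f.free) :
    dof (T.lower i) (T.upper i) (faceDof T f β i) = Polynomial.leval (f.lo i) := by
  rw [faceDof, if_neg hi]
  by_cases hl : f.lo i = T.lower i
  · simp [hl, dof]
  · simp [dof, (h.lo_eq_or i).resolve_left hl, (T.lower_lt_upper i).ne']

/-- The moments over faces are tensor products of one-dimensional degrees of freedom. -/
theorem integral_wedge_tr_formMonomial {f : Cell n} {T : BoxIntegral.Box (Fin n)}
    (h : f.IsFace T) (w : PolyForm n) {β : Fin n →₀ ℕ} {ρ : Finset (Fin n)} (hρ : ρ ⊆ f.free)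
    (hβ : β.support ⊆ f.free) :
    f.integral (wedge (f.tr w) (formMonomial β ρ)) = shuffleSign (f.free \ ρ) ρ *
      tensorLift (fun i => dof (T.lower i) (T.upper i) (faceDof T f β i)) (w (f.free \ ρ)) := by
  rw [integral_eq_tensorLift, wedge_formMonomial _ _ hρ, map_smul, smul_eq_mul,
    tr_apply _ _ Finset.sdiff_subset, mul_monomial_eq_tensorMap, tensorLift_tensorMap,
    tensorLift_tensorMap]
  congr 3
  funext i
  by_cases hi : i ∈ f.free
  · obtain ⟨h1, h2⟩ := h.eq_of_mem_free hi
    simp only [integralFactor, traceFactor, faceDof, hi, if_true, dof, h1, h2]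
    rfl
  · rw [dof_faceDof_of_notMem h β hi]
    have : β i = 0 := by
      by_contra h0
      exact hi (hβ (Finsupp.mem_support_iff.2 h0))
    ext m
    simp [integralFactor, traceFactor, hi, this]

/-- A test form `x^β dx_ρ` sees only the component `σ = f.free \ ρ`. For `i ∈ ρ` one has `i ∉ σ` and
`β i ≤ r - 2`; for the other free `i` one has `i ∈ σ` and `β i ≤ r - 1`; a direction that is not
free gives an endpoint value and lies outside `σ`. These are the three kinds of one-dimensional
degrees of freedom. -/
theorem faceDof_mem_dofSet {r : ℕ} (hr : 1 ≤ r) {f : Cell n} (T : BoxIntegral.Box (Fin n))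
    {β : Fin n →₀ ℕ} {ρ : Finset (Fin n)}
    (hβ : ∀ i, β i ≤ r - 1) (hc : cdeg (r - 1) β ρ = 0) (i : Fin n) :
    faceDof T f β i ∈ dofSet r (decide (i ∈ f.free \ ρ)) := by
  rw [cdeg, Finset.card_eq_zero, Finset.filter_eq_empty_iff] at hc
  have h1 := hβ i
  by_cases hi : i ∈ f.free
  · by_cases hiρ : i ∈ ρ
    · have := hc hiρ
      simp [faceDof, dofSet, hi, hiρ]; omega
    · simp [faceDof, dofSet, hi, hiρ]; omega
  · simp [faceDof, dofSet, hi, (em' _)]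

/-- The canonical interpolation preserves the moments over all faces. -/
theorem integral_wedge_tr_elementInterp {r k : ℕ} (hr : 1 ≤ r) {f : Cell n}
    {T : BoxIntegral.Box (Fin n)} (h : f.IsFace T) (hk : k ≤ f.dim) (u : PolyForm n)
    {v : PolyForm n} (hv : v ∈ QMinusOn f.free (r - 1) (f.dim - k)) :
    f.integral (wedge (f.tr (elementInterp r k T u)) v) = f.integral (wedge (f.tr u) v) := by
  refine Submodule.span_induction (p := fun v _ =>
    f.integral (wedge (f.tr (elementInterp r k T u)) v) = f.integral (wedge (f.tr u) v))
    ?_ ?_ ?_ ?_ hv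
  · rintro _ ⟨β, ρ, hρ, hβ, hcard, hle, hc, rfl⟩
    rw [integral_wedge_tr_formMonomial h _ hρ hβ, integral_wedge_tr_formMonomial h _ hρ hβ,
      elementInterp_apply_of_card_eq, coeffInterp, tensorLift_tensorMap]
    · congr 3
      funext i
      exact LinearMap.ext fun p => dof_interp hr (T.lower_lt_upper i) _
        (faceDof_mem_dofSet hr T hle hc i) p
    · rw [Finset.card_sdiff_of_subset hρ, hcard]
      change f.dim - (f.dim - k) = k
      omega
  · simp only [wedge_zero_right]
  · intro x y _ _ hx hy
    simp only [integral_eq_tensorLift] at hx hy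
    simp only [integral_eq_tensorLift, wedge_add_right, Pi.add_apply, map_add, hx, hy]
  · intro c x _ hx
    simp only [integral_eq_tensorLift] at hx
    simp only [integral_eq_tensorLift, wedge_smul_right, Pi.smul_apply, map_smul, hx]

theorem shuffleSign_ne_zero (σ ρ : Finset (Fin n)) : shuffleSign σ ρ ≠ 0 :=
  pow_ne_zero _ (by norm_num)

/-- The face of `T` on which the degree of freedom `j` lives. -/
def dofFace (T : BoxIntegral.Box (Fin n)) (j : Fin n → Bool ⊕ ℕ) : Cell n where
  lo i := if j i = .inl true then T.upper i else T.lower i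
  hi i := if j i = .inl false then T.lower i else T.upper i
  le i := by
    have := (T.lower_lt_upper i).le
    dsimp only
    split_ifs <;> simp_all

theorem isFace_dofFace (T : BoxIntegral.Box (Fin n)) (j : Fin n → Bool ⊕ ℕ) :
    (dofFace T j).IsFace T := by
  intro i
  rcases h : j i with (_ | _) | m <;> simp [dofFace, h]

theorem mem_free_dofFace (T : BoxIntegral.Box (Fin n)) (j : Fin n → Bool ⊕ ℕ) (i : Fin n) :
    i ∈ (dofFace T j).free ↔ ∃ m, j i = .inr m := by
  rw [Cell.free, Finset.mem_filter]
  rcases h : j i with (_ | _) | m <;> simp [dofFace, h, T.lower_lt_upper i]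

/-- Forms with the same moments over all faces have the same canonical interpolation. -/
theorem elementInterp_eq_of_moments_eq {r k : ℕ} (hr : 1 ≤ r) {T : BoxIntegral.Box (Fin n)}
    {u w : PolyForm n}
    (h : ∀ f : Cell n, f.IsFace T → k ≤ f.dim → ∀ v ∈ QMinusOn f.free (r - 1) (f.dim - k),
      f.integral (wedge (f.tr w) v) = f.integral (wedge (f.tr u) v)) :
    elementInterp r k T u = elementInterp r k T w := by
  funext σ
  by_cases hσ : σ.card = k
  swap
  · rw [elementInterp_apply_of_card_ne T u hσ, elementInterp_apply_of_card_ne T w hσ]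
  rw [elementInterp_apply_of_card_eq T u hσ, elementInterp_apply_of_card_eq T w hσ,
    coeffInterp_eq_sum, coeffInterp_eq_sum]
  refine Finset.sum_congr rfl fun j hj => ?_
  congr 1
  rw [Fintype.mem_piFinset] at hj
  -- Converse dictionary: endpoint entries of `j` fix coordinates of the face, moment entries give
  -- the exponents `β`, and the test form is `x^β` times `dx` of the complement of `σ` in the free
  -- directions.
  set f := dofFace T j with hf
  let β : Fin n →₀ ℕ := Finsupp.equivFunOnFinite.symm fun i => (j i).elim (fun _ => 0) id
  have hβ_apply : ∀ i, β i = (j i).elim (fun _ => 0) id := fun i => rfl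
  have hface : f.IsFace T := isFace_dofFace T j
  -- In the directions of `σ` there are no endpoint degrees of freedom.
  have hσf : σ ⊆ f.free := fun i hi => by
    rw [hf, mem_free_dofFace]
    have := hj i
    rcases hji : j i with c | m
    · simp [dofSet, hi, hji] at this
    · exact ⟨m, rfl⟩
  have hk : k ≤ f.dim := hσ ▸ Finset.card_le_card hσf
  have hsupp : β.support ⊆ f.free := fun i hi => by
    rw [hf, mem_free_dofFace]
    rw [Finsupp.mem_support_iff, hβ_apply] at hi
    rcases hji : j i with c | m
    · simp [hji] at hi
    · exact ⟨m, rfl⟩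
  have hdof : ∀ i, faceDof T f β i = j i := fun i => by
    have hne := (T.lower_lt_upper i).ne'
    rcases hji : j i with c | m
    · have : i ∉ f.free := by rw [hf, mem_free_dofFace]; simp [hji]
      rw [faceDof, if_neg this]
      cases c <;> simp [hf, dofFace, hji, hne]
    · have : i ∈ f.free := by rw [hf, mem_free_dofFace]; exact ⟨m, hji⟩
      rw [faceDof, if_pos this, hβ_apply, hji]
      rfl
  have hmem : formMonomial β (f.free \ σ) ∈ QMinusOn f.free (r - 1) (f.dim - k) := by
    refine Submodule.subset_span ⟨β, f.free \ σ, Finset.sdiff_subset, hsupp, ?_, fun i => ?_, ?_,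
      rfl⟩
    · rw [Finset.card_sdiff_of_subset hσf, hσ]; rfl
    · have := hj i
      rw [hβ_apply]
      rcases hji : j i with c | m
      · simp
      · by_cases hi : i ∈ σ <;> simp [dofSet, hi, hji] at this ⊢ <;> omega
    · rw [cdeg, Finset.card_eq_zero, Finset.filter_eq_empty_iff]
      intro i hi
      rw [Finset.mem_sdiff, hf, mem_free_dofFace] at hi
      obtain ⟨⟨m, hm⟩, hiσ⟩ := hi
      have := hj i
      simp [dofSet, hiσ, hm] at this
      rw [hβ_apply, hm]
      simp; omega
  have := h f hface hk _ hmem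
  rw [integral_wedge_tr_formMonomial hface _ Finset.sdiff_subset hsupp,
    integral_wedge_tr_formMonomial hface _ Finset.sdiff_subset hsupp,
    Finset.sdiff_sdiff_eq_self hσf] at this
  have := mul_left_cancel₀ (shuffleSign_ne_zero _ _) this
  simpa only [hdof] using this.symm

/-- The trace of the interpolation on a face is determined by the trace on that face. -/
theorem tr_elementInterp {r : ℕ} (hr : 1 ≤ r) (k : ℕ) {f : Cell n}
    {T : BoxIntegral.Box (Fin n)} (h : f.IsFace T) (u : PolyForm n) (σ : Finset (Fin n)) :
    f.tr (elementInterp r k T u) σ = if σ.card = k then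
      tensorMap (fun i => if i ∈ f.free then interp r (decide (i ∈ σ)) (f.lo i) (f.hi i)
        else LinearMap.id) (f.tr u σ) else 0 := by
  by_cases hf : σ ⊆ f.free
  swap
  · simp [Cell.tr, hf]
  by_cases hσ : σ.card = k
  swap
  · rw [tr_apply _ _ hf, elementInterp_apply_of_card_ne T u hσ, map_zero, if_neg hσ]
  rw [tr_apply _ _ hf, tr_apply _ _ hf, if_pos hσ, elementInterp_apply_of_card_eq T u hσ,
    coeffInterp, tensorMap_tensorMap, tensorMap_tensorMap]
  congr 2
  funext i
  by_cases hi : i ∈ f.free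
  · obtain ⟨h1, h2⟩ := h.eq_of_mem_free hi
    simp only [traceFactor, hi, if_true, h1, h2]
    rfl
  · have hiσ : i ∉ σ := fun h' => hi (hf h')
    refine LinearMap.ext fun p => ?_
    have := dof_interp hr (T.lower_lt_upper i) (decide (i ∈ σ)) (i := faceDof T f 0 i)
      (by simp [faceDof, dofSet, hi, hiσ, (em' _)]) p
    rw [dof_faceDof_of_notMem h 0 hi] at this
    simp only [Polynomial.leval_apply] at this
    simp [traceFactor, hi, this]

end Faces

/-! ### Quadrature orthogonality on a box -/

section Quadrature

theorem evalE_eq_tensorLift (r : ℕ) (T : BoxIntegral.Box (Fin n)) (p : MvPolynomial (Fin n) ℝ) :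
    evalE r T (fun x => MvPolynomial.eval x p) =
      tensorLift (fun i => glFunctional r (T.lower i) (T.upper i)) p := by
  let I : MvPolynomial (Fin n) ℝ →ₗ[ℝ] ℝ :=
    ∑ ξ ∈ Fintype.piFinset (fun _ : Fin n => glNodes r),
      (∏ i, glWeight r (ξ i) / 2) • (MvPolynomial.aeval (fromRef T ξ)).toLinearMap
  have hI : ∀ q, I q = evalE r T (fun x => MvPolynomial.eval x q) := fun q => by
    simp [I, evalE, LinearMap.sum_apply, MvPolynomial.aeval_eq_eval]
  rw [← hI]
  refine LinearMap.congr_fun (linearMap_ext_monomial fun α => ?_) p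
  rw [hI, tensorLift_monomial, evalE]
  simp only [glFunctional_apply, Finset.prod_univ_sum]
  refine Finset.sum_congr rfl fun ξ _ => ?_
  rw [monomial_eq_prod, map_prod, ← Finset.prod_mul_distrib]
  exact Finset.prod_congr rfl fun i _ => by simp [fromRef]

theorem mem_degreeBox_of_mem_Q {s k : ℕ} {v : PolyForm n} (hv : v ∈ Q n s k)
    (σ : Finset (Fin n)) : v σ ∈ degreeBox (fun _ => s) := by
  have : Q n s k ≤ (degreeBox (fun _ => s)).comap (LinearMap.proj σ) := by
    rw [Q, Submodule.span_le]
    rintro _ ⟨α, τ, -, hα, rfl⟩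
    simp only [SetLike.mem_coe, Submodule.mem_comap, LinearMap.proj_apply, formMonomial,
      Pi.single_apply]
    split_ifs
    · exact monomial_mem_degreeBox hα 1
    · exact Submodule.zero_mem _
  exact this hv

theorem degreeBox_mono {N N' : Fin n → ℕ} (h : ∀ i, N i ≤ N' i) : degreeBox N ≤ degreeBox N' :=
  Submodule.span_mono fun _ ⟨α, hα, e⟩ => ⟨α, fun i => (hα i).trans (h i), e⟩

/-- The components of forms in `Q̃_r Λ^k` are of at most one degree more than those of
`Q_r^- Λ^k`. -/
theorem mem_degreeBox_of_mem_QTilde {r k : ℕ} (hr : 1 ≤ r) {u : PolyForm n}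
    (hu : u ∈ QTilde n r k) (τ : Finset (Fin n)) :
    u τ ∈ degreeBox (fun i => shapeDim r (decide (i ∈ τ))) := by
  have : QTilde n r k ≤
      (degreeBox (fun i => shapeDim r (decide (i ∈ τ)))).comap (LinearMap.proj τ) := by
    refine sup_le (fun u hu => ?_) ?_
    · exact degreeBox_mono (fun i => Nat.sub_le _ _) (((mem_QMinus_iff hr).1 hu).2 τ)
    rw [B, Submodule.map_span, Submodule.span_le]
    rintro _ ⟨_, ⟨α, σ, -, hα, -, rfl⟩, rfl⟩
    simp only [SetLike.mem_coe, Submodule.mem_comap, LinearMap.proj_apply, LinearMap.comp_apply,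
      extD, koszul, LinearMap.coe_mk, AddHom.coe_mk, formMonomial, map_sum]
    refine Submodule.sum_mem _ fun i hi => Submodule.smul_mem _ _ ?_
    refine Submodule.sum_mem _ fun j hj => ?_
    rw [Derivation.map_smul]
    refine Submodule.smul_mem _ _ ?_
    rw [Pi.single_apply]
    split_ifs
    swap
    · simp
    rw [MvPolynomial.X, MvPolynomial.monomial_mul, MvPolynomial.pderiv_monomial]
    refine monomial_mem_degreeBox (fun l => ?_) _
    have h1 := hα l
    -- The term is `∂_i (x_j x^α)` with `j` outside `τ.erase i`. A direction in `τ` is thus raised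
    -- by `x_j` only if `∂_i` lowers it again, and its exponent stays at most `r`; the other
    -- directions may reach `r + 1`.
    have h2 : j ∈ τ → j = i := fun h => by
      simpa [h] using hj
    by_cases hl : l ∈ τ
    · by_cases hlj : l = j
      · subst hlj
        obtain rfl := h2 hl
        simp [shapeDim, hl]; omega
      · simp [shapeDim, hl, hlj, Finsupp.single_apply]; omega
    · simp [shapeDim, hl, Finsupp.single_apply]
      split_ifs <;> omega
  exact this hu

/-- The interpolation error is orthogonal, in the quadrature inner product on `T`, to forms of
degree less than `r`. -/
theorem quadInnerOn_sub_elementInterp {r k : ℕ} (hr : 1 ≤ r) (T : BoxIntegral.Box (Fin n))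
    {u v : PolyForm n} (hu : u ∈ QTilde n r k) (hv : v ∈ Q n (r - 1) k) :
    quadInnerOn r k T (u - elementInterp r k T u) v = 0 := by
  rw [quadInnerOn]
  refine mul_eq_zero_of_right _ (Finset.sum_eq_zero fun σ hσ => ?_)
  have hσ' := (Finset.mem_powersetCard.1 hσ).2
  simp only [← map_mul]
  rw [evalE_eq_tensorLift, Pi.sub_apply, elementInterp_apply_of_card_eq T u hσ', sub_mul, map_sub,
    sub_eq_zero]
  -- By linearity `v` may be taken to be a monomial; both sides then factor over the coordinates,
  -- and `glFunctional_interp_mul` compares the factors.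
  refine linearMap_congr_degreeBox
    (f := tensorLift (fun i => glFunctional r (T.lower i) (T.upper i)) ∘ₗ
      LinearMap.mulLeft ℝ (u σ))
    (g := tensorLift (fun i => glFunctional r (T.lower i) (T.upper i)) ∘ₗ
      LinearMap.mulLeft ℝ (coeffInterp r T σ (u σ)))
    (fun β hβ => ?_) (mem_degreeBox_of_mem_Q hv σ)
  simp only [LinearMap.comp_apply, LinearMap.mulLeft_apply]
  rw [mul_monomial_eq_tensorMap, mul_monomial_eq_tensorMap, coeffInterp, tensorMap_tensorMap,
    tensorLift_tensorMap, tensorLift_tensorMap]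
  refine tensorLift_congr (fun i m hm => ?_) (mem_degreeBox_of_mem_QTilde hr hu σ)
  refine (glFunctional_interp_mul hr (T.lower_lt_upper i) _ ?_ ?_).symm
  · rw [Polynomial.degree_X_pow]
    exact_mod_cast Nat.lt_succ_iff.2 hm
  · rw [Polynomial.degree_X_pow]
    have := hβ i
    exact_mod_cast (by omega : β i < r)

end Quadrature

/-! ### The global projection -/

/-- The canonical interpolation operator on the mesh. -/
def meshInterp {r : ℕ} (hr : 1 ≤ r) (k : ℕ) (𝒯 : CubicalMesh n) :
    𝒯.QTildeSpace r k →ₗ[ℝ] 𝒯.QMinusSpace r k where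
  toFun u := ⟨fun T => elementInterp r k T.1 (u.1 T),
    fun T => elementInterp_mem_QMinus hr k T.1 _, fun T T' f h h' => by
      funext σ
      rw [tr_elementInterp hr k h, tr_elementInterp hr k h', u.2.2 T T' f h h']⟩
  map_add' u v := by
    ext1
    funext T
    exact map_add (elementInterp r k T.1) _ _
  map_smul' c u := by
    ext1
    funext T
    exact map_smul (elementInterp r k T.1) _ _

theorem meshInterp_apply {r : ℕ} (hr : 1 ≤ r) (k : ℕ) (𝒯 : CubicalMesh n)
    (u : 𝒯.QTildeSpace r k) (T : {T // T ∈ 𝒯.cells}) :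
    (meshInterp hr k 𝒯 u : 𝒯.PiecewiseForm) T = elementInterp r k T.1 (u.1 T) := rfl

/-- Uniqueness: equal moments give equal interpolants on each element, and `w`, being in `Q_r^-`, is
its own interpolant. -/
theorem meshInterp_eq_iff {r : ℕ} (hr : 1 ≤ r) (k : ℕ) (𝒯 : CubicalMesh n)
    (u : 𝒯.QTildeSpace r k) (w : 𝒯.QMinusSpace r k) :
    meshInterp hr k 𝒯 u = w ↔ 𝒯.SameDOF r k (u : 𝒯.PiecewiseForm) (w : 𝒯.PiecewiseForm) := by
  constructor
  · rintro rfl T f hf hk v hv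
    exact integral_wedge_tr_elementInterp hr hf hk _ hv
  · intro h
    ext1
    funext T
    rw [meshInterp_apply, elementInterp_eq_of_moments_eq hr (h T),
      elementInterp_eq_self hr T.1 (w.2.1 T)]

end CubicalForms
end

theorem mainTheorem5 (n k r : ℕ) (hr : 1 ≤ r) (𝒯 : CubicalForms.CubicalMesh n) :
    ∃ P : 𝒯.QTildeSpace r k →ₗ[ℝ] 𝒯.QMinusSpace r k,
      (∀ (u : 𝒯.QTildeSpace r k) (w : 𝒯.QMinusSpace r k),
        P u = w ↔ 𝒯.SameDOF r k (u : 𝒯.PiecewiseForm) (w : 𝒯.PiecewiseForm)) ∧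
      ∀ (u : 𝒯.QTildeSpace r k) (v : 𝒯.PiecewiseForm), v ∈ 𝒯.QDiscSpace (r - 1) k →
        𝒯.quadInner r k ((u : 𝒯.PiecewiseForm) - (P u : 𝒯.PiecewiseForm)) v = 0 := by
  refine ⟨CubicalForms.meshInterp hr k 𝒯, CubicalForms.meshInterp_eq_iff hr k 𝒯,
    fun u v hv => Finset.sum_eq_zero fun T _ => ?_⟩
  exact CubicalForms.quadInnerOn_sub_elementInterp hr T.1 (u.2.1 T) (hv T (Set.mem_univ T))
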